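/- **Theorem 1.3 (Convergence of Thurston's algorithm).** Let $S$ be a closed oriented surface, and let $G$ be a finite graph on $S$ with edge set $E$ and face set $F$, all of whose faces are simply connected (an edge may have the same face on both sides). Let $\Theta:E\to(0,\pi/2]$ be a weight function. *Patterns.* For $\alpha>0$ and $0<r<\pi/2$ let $D_\alpha(r)$ be the open conical spherical disk of cone angle $\alpha$ and radius $r$. Its boundary circle has geodesic curvature $k=\cot r$, length $\alpha\sin r$, and total geodesic curvature $T=\alpha\cos r$. An ideal circle pattern for $(S,G,\Theta)$ consists of a conical spherical metric on $S$ and, for each $f\in F$, a conical spherical disk $D_f$ of radius in $(0,\pi/2)$, together with a local isometry of $\bigsqcup_f D_f$ onto $S$ minus the vertices of $G$, such that: this map is at most two to one; no disk has its image contained in the image of another; the regions where disks overlap are bigons, which fill up the boundary of each disk, correspond to the edges of $G$ in the cyclic order given by the faces of $G$, and have interior angle $\Theta(e)$ for each edge $e$. Patterns are considered up to isometries isotopic to the identity. They have vectors $\mathbf k,\mathbf T:F\to(0,\infty)$ of geodesic curvatures and total geodesic curvatures of the boundary circles. A sequence of patterns converges if the radii and cone angles of the disks, and the central angles and the distances of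 centers that determine the bigons, converge. *Target.* For $F'\subset F$ let $E(F')$ be the set of edges of faces in $F'$, and let $$\mathcal T=\Big\{\mathbf T:F\to(0,\infty)\ \Big|\ \sum_{f\in F'}\mathbf T(f)<\sum_{e\in E(F')}2\Theta(e)\ \text{ for all } \emptyset\ne F'\subset F\Big\}.$$ Let $\hat{\mathbf T}\in\mathcal T$. Then there is a pattern $\hat{\mathcal D}$ for $(S,G,\Theta)$, unique up to isometry, whose vector of total geodesic curvatures is $\hat{\mathbf T}$. Let $\hat{\mathbf k}$ be its vector of geodesic curvatures. *Algorithm.* Given a pattern $\mathcal D^m$ for $(S,G,\Theta)$ with vector $\mathbf k^m$, for each $f\in F$ separately change the geodesic curvature of the circle of $f$ in $\mathcal D^m$, keeping the geodesic curvatures of all other circles and all angles $\Theta$, to the value $\mathbf k^{m+1}(f)$ for which the total geodesic curvature of the circle of $f$ becomes $\hat{\mathbf T}(f)$. Let $\mathcal D^{m+1}$ be the pattern for $(S,G,\Theta)$ with geodesic curvatures $\mathbf k^{m+1}$, and let $\mathbf T^{m+1}$ be its vector of total geodesic curvatures. *Claim.* For every initial pattern $\mathcal D^0$ for $(S,G,\Theta)$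 the algorithm can be carried out, and the patterns $\mathcal D^m$ converge to $\hat{\mathcal D}$, with $\lim_{m\to\infty}\mathbf k^m=\hat{\mathbf k}$ and $\lim_{m\to\infty}\mathbf T^m=\hat{\mathbf T}$. Furthermore, if $\mathbf T^0\le\hat{\mathbf T}$, then for every $f\in F$ the sequence $\mathbf k^m(f)$ is nondecreasing, with limit $\hat{\mathbf k}(f)$, and $\mathbf T^m\le\hat{\mathbf T}$ for all $m$; if $\mathbf T^0\ge\hat{\mathbf T}$, then for every $f\in F$ the sequence $\mathbf k^m(f)$ is nonincreasing, with limit $\hat{\mathbf k}(f)$, and $\mathbf T^m\ge\hat{\mathbf T}$ for all $m$. -/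

import Mathlib

noncomputable section

/-! ### Graphs on closed oriented surfaces -/

/-- A graph that cuts a closed oriented surface into polygons (simply connected faces), up to
isotopy, given by its darts (sides of the face polygons, i.e. oriented edges with the face on the
left).  `opp` reverses the orientation of a dart, and `next d` is the dart that follows `d` on the
boundary of the face to its left, counterclockwise as seen from inside that face.  The surface is
obtained from the face polygons by gluing the side `d` to the side `opp d`; its vertices are the
orbits of `d ↦ next (opp d)`.  An edge may have the same face on both sides. -/
structure SurfaceGraph (Dart : Type*) where
  opp : Equiv.Perm Dart
  next : Equiv.Perm Dart
  opp_opp : ∀ d, opp (opp d) = d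
  opp_ne : ∀ d, opp d ≠ d

namespace SurfaceGraph

variable {Dart : Type*} (M : SurfaceGraph Dart)

/-- Edges: the orbits `{d, opp d}`. -/
def Edge : Type _ := Quotient (Equiv.Perm.SameCycle.setoid M.opp)

/-- Faces: the orbits of `next`. -/
def Face : Type _ := Quotient (Equiv.Perm.SameCycle.setoid M.next)

/-- The edge underlying a dart. -/
def edge (d : Dart) : M.Edge := Quotient.mk (Equiv.Perm.SameCycle.setoid M.opp) d

/-- The face to the left of a dart. -/
def face (d : Dart) : M.Face := Quotient.mk (Equiv.Perm.SameCycle.setoid M.next) d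

instance [Finite Dart] : Finite M.Edge := by unfold Edge; infer_instance

instance [Finite Dart] : Finite M.Face := by unfold Face; infer_instance

instance [Finite Dart] : Fintype M.Edge := Fintype.ofFinite _

instance [Finite Dart] : Fintype M.Face := Fintype.ofFinite _

open Classical in
/-- `E(F')`: the edges of the faces in `F'`. -/
def edgesOf [Finite Dart] (F' : Finset M.Face) : Finset M.Edge :=
  Finset.univ.filter fun e => ∃ d : Dart, M.edge d = e ∧ M.face d ∈ F'

/-- The set `𝒯` of admissible total geodesic curvatures. -/
def admissible [Finite Dart] (Θ : M.Edge → ℝ) : Set (M.Face → ℝ) :=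
  {T | (∀ f, 0 < T f) ∧
    ∀ F' : Finset M.Face, F'.Nonempty → ∑ f ∈ F', T f < ∑ e ∈ M.edgesOf F', 2 * Θ e}

end SurfaceGraph

/-! ### Conical spherical disks -/

/-- The open conical spherical disk of cone angle `α` and radius `r`: its center (the cone point),
and the points with polar coordinates `ρ ∈ (0, r)` and `φ ∈ ℝ / αℤ`. -/
inductive ConicalDisk (α r : ℝ) : Type
  | center : ConicalDisk α r
  | polar (ρ : Set.Ioo 0 r) (φ : AddCircle α) : ConicalDisk α r

namespace ConicalDisk

variable {α r : ℝ}

/-- Distance from the center. -/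
def rad : ConicalDisk α r → ℝ
  | center => 0
  | polar ρ _ => ρ

/-- Angular coordinate (with an irrelevant value at the center). -/
def ang : ConicalDisk α r → AddCircle α
  | center => 0
  | polar _ φ => φ

/-- The spherical cone metric: the spherical law of cosines, where the angle at the center between
two radii is their distance on the circle `ℝ / αℤ`, cut off at `π`. -/
def coneDist (x y : ConicalDisk α r) : ℝ :=
  Real.arccos (Real.cos x.rad * Real.cos y.rad +
    Real.sin x.rad * Real.sin y.rad * Real.cos (min ‖x.ang - y.ang‖ Real.pi))

end ConicalDisk

/-! ### Two disks on the unit sphere -/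

/-- Points of `ℝ³`; the unit sphere is the set of unit vectors. -/
abbrev Space3 : Type := EuclideanSpace ℝ (Fin 3)

/-- The north pole of the unit sphere. -/
def northPole : Space3 := !₂[0, 0, 1]

/-- The point of the unit sphere at distance `ρ` from the north pole in the direction `t`. -/
def spherePoint (ρ t : ℝ) : Space3 :=
  !₂[Real.sin ρ * Real.cos t, Real.sin ρ * Real.sin t, Real.cos ρ]

/-- The rotation of the sphere by `π` about `spherePoint (ℓ / 2) 0`.  It exchanges the north pole
with the point `spherePoint ℓ 0` at distance `ℓ` from it. -/
def halfTurn (ℓ : ℝ) (v : Space3) : Space3 :=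
  !₂[-Real.cos ℓ * v 0 + Real.sin ℓ * v 2, -v 1, Real.sin ℓ * v 0 + Real.cos ℓ * v 2]

/-- The angle at `p` between the great circle arcs from `p` to `a` and from `p` to `b`. -/
def sphericalAngle (p a b : Space3) : ℝ :=
  InnerProductGeometry.angle (a - (inner ℝ a p : ℝ) • p) (b - (inner ℝ b p : ℝ) • p)

/-- The interior angle at `p` of the intersection of two spherical disks with centers `a` and `b`
whose boundary circles pass through `p`.  The radii at `p` are the inner normals of the disks. -/
def bigonAngle (p a b : Space3) : ℝ := Real.pi - sphericalAngle p a b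

/-! ### Ideal spherical circle patterns -/

/-- The data of a circle pattern with graph `M`: a conical disk for every face, and for every dart
`d` of a face `f` the arc of the circle of `f` that bounds the bigon of `d`, running
counterclockwise from the angular coordinate `start d` and of central angle `centralAngle d`.
`centerDist` is the length of the geodesic that joins the two centers through the bigon of an
edge. -/
structure PatternData {Dart : Type*} (M : SurfaceGraph Dart) where
  radius : M.Face → ℝ
  coneAngle : M.Face → ℝ
  start : Dart → ℝ
  centralAngle : Dart → ℝ
  centerDist : M.Edge → ℝ

namespace PatternData

variable {Dart : Type*} {M : SurfaceGraph Dart} (P : PatternData M)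

/-- The conical disk of a face. -/
abbrev Disk (f : M.Face) : Type := ConicalDisk (P.coneAngle f) (P.radius f)

/-- `SectorPoint d x ρ t` says that `x` has radial coordinate `ρ` and lies in the open sector over
the arc of `d`, at the angle `t` from the bisector of that sector. -/
def SectorPoint (d : Dart) (x : P.Disk (M.face d)) (ρ t : ℝ) : Prop :=
  |t| < P.centralAngle d / 2 ∧
    ∃ h : ρ ∈ Set.Ioo 0 (P.radius (M.face d)),
      x = .polar ⟨ρ, h⟩ ((P.start d + P.centralAngle d / 2 + t : ℝ) : AddCircle _)

/-- The gluing of the disks on the two sides of `d` along their bigon.  The sectors of `d` and of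
`opp d` are laid out isometrically on the unit sphere, the first with its center at the north pole
and the second with its center at distance `centerDist`, their bisectors pointing at one another;
points are identified if they are laid out at the same place. -/
def Glued (d : Dart) (x : P.Disk (M.face d)) (y : P.Disk (M.face (M.opp d))) : Prop :=
  ∃ ρ t ρ' t' : ℝ, P.SectorPoint d x ρ t ∧ P.SectorPoint (M.opp d) y ρ' t' ∧
    spherePoint ρ t = halfTurn (P.centerDist (M.edge d)) (spherePoint ρ' t')

/-- The identifications on the disjoint union of the disks. -/
inductive Glue : (Σ f, P.Disk f) → (Σ f, P.Disk f) → Prop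
  | mk (d : Dart) (x : P.Disk (M.face d)) (y : P.Disk (M.face (M.opp d))) (h : P.Glued d x y) :
      Glue ⟨M.face d, x⟩ ⟨M.face (M.opp d), y⟩

/-- The surface without the vertices of the graph.  The identifications are restrictions of
rotations of the unit sphere, so the metrics of the disks agree locally where disks overlap and
define the conical spherical metric of the surface. -/
def PuncturedSurface : Type _ := Quot P.Glue

/-- The map of the disjoint union of the disks onto the surface without the vertices. -/
def toSurface (x : Σ f, P.Disk f) : P.PuncturedSurface := Quot.mk P.Glue x

end PatternData

/-- An ideal spherical circle pattern with the weighted graph `(M, Θ)`. -/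
structure IdealCirclePattern {Dart : Type*} [Finite Dart] (M : SurfaceGraph Dart)
    (Θ : M.Edge → ℝ) extends PatternData M where
  radius_mem : ∀ f, radius f ∈ Set.Ioo 0 (Real.pi / 2)
  coneAngle_pos : ∀ f, 0 < coneAngle f
  centralAngle_mem : ∀ d, centralAngle d ∈ Set.Ioo 0 (2 * Real.pi)
  centerDist_mem : ∀ e, centerDist e ∈ Set.Ioo 0 Real.pi
  /-- The bigons follow one another around each disk in the order prescribed by the graph. -/
  start_next : ∀ d, ((start (M.next d) : ℝ) : AddCircle (coneAngle (M.face d))) =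
    ((start d + centralAngle d : ℝ) : AddCircle (coneAngle (M.face d)))
  /-- The bigons of a disk fill up its boundary exactly once. -/
  sum_centralAngle : ∀ f, ∑ᶠ d ∈ {d | M.face d = f}, centralAngle d = coneAngle f
  /-- On the two sides of an edge, the arcs end at the same corners: the end of the arc of `d` is
  the beginning of the arc of `opp d`. -/
  corner : ∀ d, spherePoint (radius (M.face d)) (centralAngle d / 2) =
    halfTurn (centerDist (M.edge d))
      (spherePoint (radius (M.face (M.opp d))) (-(centralAngle (M.opp d) / 2)))
  /-- The bigon of an edge `e` has interior angle `Θ e`. -/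
  angle_eq : ∀ d, bigonAngle (spherePoint (radius (M.face d)) (centralAngle d / 2)) northPole
    (spherePoint (centerDist (M.edge d)) 0) = Θ (M.edge d)
  /-- The map of the disks to the surface is at most two to one. -/
  at_most_two_to_one : ∀ p, (toPatternData.toSurface ⁻¹' {p}).encard ≤ 2
  /-- No disk of the pattern is contained in another one. -/
  not_subset : ∀ f g, f ≠ g → ¬ (Set.range fun x => toPatternData.toSurface ⟨f, x⟩) ⊆
    Set.range fun x => toPatternData.toSurface ⟨g, x⟩

namespace IdealCirclePattern

variable {Dart : Type*} [Finite Dart] {M : SurfaceGraph Dart} {Θ : M.Edge → ℝ}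

/-- Geodesic curvature of the boundary circle of the disk of `f`. -/
def geodesicCurvature (P : IdealCirclePattern M Θ) (f : M.Face) : ℝ := Real.cot (P.radius f)

/-- Length of the boundary circle of the disk of `f`. -/
def circumference (P : IdealCirclePattern M Θ) (f : M.Face) : ℝ :=
  P.coneAngle f * Real.sin (P.radius f)

/-- Total geodesic curvature of the boundary circle of the disk of `f`. -/
def totalCurvature (P : IdealCirclePattern M Θ) (f : M.Face) : ℝ :=
  P.geodesicCurvature f * P.circumference f

/-- Isometry of patterns with the same graph, isotopic to the identity: isometries between the
disks of each face that carry the sector of each dart to the sector of the same dart, preserving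
its orientation, and respect the gluing along the bigon of each edge, hence induce an isometry of
the surfaces. -/
def Isometric (P Q : IdealCirclePattern M Θ) : Prop :=
  ∃ h : ∀ f, P.Disk f ≃ Q.Disk f,
    (∀ f x y, (h f x).coneDist (h f y) = x.coneDist y) ∧
    (∀ d x ρ t, Q.SectorPoint d (h _ x) ρ t ↔ P.SectorPoint d x ρ t) ∧
    ∀ d x y, Q.Glued d (h _ x) (h _ y) ↔ P.Glued d x y

/-- Convergence of patterns up to isometry: convergence of the radii and cone angles of the disks,
and of the central angles and the distances of centers that determine the bigons. -/
def ConvergesTo (P : ℕ → IdealCirclePattern M Θ) (Q : IdealCirclePattern M Θ) : Prop :=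
  (∀ f, Filter.Tendsto (fun m => (P m).radius f) Filter.atTop (nhds (Q.radius f))) ∧
  (∀ f, Filter.Tendsto (fun m => (P m).coneAngle f) Filter.atTop (nhds (Q.coneAngle f))) ∧
  (∀ d, Filter.Tendsto (fun m => (P m).centralAngle d) Filter.atTop (nhds (Q.centralAngle d))) ∧
  ∀ e, Filter.Tendsto (fun m => (P m).centerDist e) Filter.atTop (nhds (Q.centerDist e))

/-- `Adjusted T f P Q`: the pattern `Q` arises from `P` by changing only the geodesic curvature of
the circle of `f`, so that its total geodesic curvature becomes `T f`. -/
def Adjusted (T : M.Face → ℝ) (f : M.Face) (P Q : IdealCirclePattern M Θ) : Prop :=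
  (∀ g, g ≠ f → Q.geodesicCurvature g = P.geodesicCurvature g) ∧ Q.totalCurvature f = T f

/-- One round of Thurston's algorithm: the new geodesic curvature of the circle of each face `f` is
the one that it gets when that circle alone is adjusted in `P`. -/
def ThurstonStep (T : M.Face → ℝ) (P P' : IdealCirclePattern M Θ) : Prop :=
  ∀ f, ∃ Q, Adjusted T f P Q ∧ P'.geodesicCurvature f = Q.geodesicCurvature f

/-- A sequence of patterns produced by Thurston's algorithm from its initial pattern. -/
def IsThurstonSequence (T : M.Face → ℝ) (P : ℕ → IdealCirclePattern M Θ) : Prop :=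
  ∀ m, ThurstonStep T (P m) (P (m + 1))

end IdealCirclePattern

end

noncomputable section

open Real Filter Topology

/-! ### The curvature of one arc -/

/-! The proof turns geometry into a monotone nonlinear system. The geodesic curvatures of two
circles and the angle of their bigon determine the bigon, by spherical trigonometry. So a pattern is
determined up to isometry by its vector `k`, every positive `k` occurs, and the total curvatures are
an explicit function `faceCurvature` of `k`, a sum of `arcCurvature` over the sides of a face. It
remains to solve `faceCurvature k = T` and to study the nonlinear Jacobi iteration `CurvatureStep`
for it.

Three facts about one bigon suffice. The curvature of an arc falls when the opposite circle is
curved more; the sum over both arcs of a bigon grows with either curvature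
(`arcCurvature_add_swap_lt`); scaling both curvatures by `s ≥ 1` does not lower the curvature of an
arc (`arcCurvature_le_arcCurvature_mul`). The last two come down to `sin 2A < 2A`.

The first two give a maximum principle (`sum_faceCurvature_lt`): raising `k` exactly on `F'` raises
the total over `F'`. Hence solutions are unique, the adjustment of one face is unique, and a step
preserves order (`CurvatureStep.mono`). It moves subsolutions up and supersolutions down, keeping
them such. Subsolutions stay bounded: if `k` were unbounded exactly on `F'`, the total over `F'`
would approach at least the sum of `2 * Θ e` over the edges of `F'`, against admissibility.
Supersolutions stay away from `0`. So both converge, and the limit is a solution.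

By the scaling fact, multiples `s • l` and `s⁻¹ • l` of the solution `l` are a super- and a
subsolution. Any start lies between two such multiples, and order preservation squeezes its orbit
onto `l` (`curvatureSeq_tendsto`). -/

/-- Half of the central angle of the arc that a circle of geodesic curvature `y` cuts out on a
circle of geodesic curvature `x`, when they bound a bigon of angle `θ`. -/
def halfAngle (θ x y : ℝ) : ℝ := π / 2 - arctan ((y + x * cos θ) / (sin θ * √(1 + x ^ 2)))

/-- Total geodesic curvature of the arc that a circle of geodesic curvature `y` cuts out on a
circle of geodesic curvature `x`, when they bound a bigon of angle `θ`. -/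
def arcCurvature (θ x y : ℝ) : ℝ := x / √(1 + x ^ 2) * (2 * halfAngle θ x y)

theorem sqrt_one_add_sq_pos (x : ℝ) : 0 < √(1 + x ^ 2) := by positivity

theorem halfAngle_lt_pi_div_two {θ x y : ℝ} (hθ : θ ∈ Set.Ioc 0 (π / 2)) (hx : 0 < x)
    (hy : 0 < y) : halfAngle θ x y < π / 2 := by
  have hs : 0 < sin θ := sin_pos_of_pos_of_lt_pi hθ.1 (by linarith [hθ.2, pi_pos])
  have hc : 0 ≤ cos θ := cos_nonneg_of_mem_Icc ⟨by linarith [hθ.1, pi_pos], hθ.2⟩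
  have : 0 < (y + x * cos θ) / (sin θ * √(1 + x ^ 2)) := by positivity
  have := arctan_pos.2 this
  unfold halfAngle; linarith

theorem halfAngle_pos (θ x y : ℝ) : 0 < halfAngle θ x y := by
  have := arctan_lt_pi_div_two ((y + x * cos θ) / (sin θ * √(1 + x ^ 2)))
  unfold halfAngle; linarith

theorem halfAngle_lt_of_lt {θ x y y' : ℝ} (hθ : 0 < sin θ) (h : y < y') :
    halfAngle θ x y' < halfAngle θ x y := by
  unfold halfAngle
  have := sqrt_one_add_sq_pos x
  gcongr

theorem arcCurvature_pos {x : ℝ} (θ y : ℝ) (hx : 0 < x) : 0 < arcCurvature θ x y := by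
  have := sqrt_one_add_sq_pos x
  have := halfAngle_pos θ x y
  unfold arcCurvature; positivity

theorem arcCurvature_lt_of_lt {θ x y y' : ℝ} (hθ : 0 < sin θ) (hx : 0 < x) (h : y < y') :
    arcCurvature θ x y' < arcCurvature θ x y := by
  have := sqrt_one_add_sq_pos x
  have := halfAngle_lt_of_lt (x := x) hθ h
  unfold arcCurvature
  gcongr

theorem arcCurvature_le_of_le {θ x y y' : ℝ} (hθ : 0 < sin θ) (hx : 0 < x) (h : y ≤ y') :
    arcCurvature θ x y' ≤ arcCurvature θ x y := by
  rcases h.eq_or_lt with rfl | h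
  · rfl
  · exact (arcCurvature_lt_of_lt hθ hx h).le

/-- This linear bound shows that small geodesic curvatures have small total curvatures, uniformly in
the neighbours. It supplies subsolutions and keeps supersolutions away from zero. -/
theorem arcCurvature_le_mul {θ x y : ℝ} (hθ : θ ∈ Set.Ioc 0 (π / 2)) (hx : 0 < x) (hy : 0 < y) :
    arcCurvature θ x y ≤ x * π := by
  have h1 := halfAngle_lt_pi_div_two hθ hx hy
  have h2 := halfAngle_pos θ x y
  have h3 : 1 ≤ √(1 + x ^ 2) := by
    rw [Real.one_le_sqrt]; nlinarith
  have h4 : x / √(1 + x ^ 2) ≤ x := div_le_self hx.le h3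
  unfold arcCurvature
  exact mul_le_mul h4 (by linarith) (by linarith) hx.le

theorem continuous_arcCurvature {θ : ℝ} (hθ : 0 < sin θ) :
    Continuous fun p : ℝ × ℝ => arcCurvature θ p.1 p.2 := by
  unfold arcCurvature halfAngle
  have h1 : ∀ p : ℝ × ℝ, √(1 + p.1 ^ 2) ≠ 0 := fun p => (sqrt_one_add_sq_pos p.1).ne'
  have h2 : ∀ p : ℝ × ℝ, sin θ * √(1 + p.1 ^ 2) ≠ 0 := fun p => mul_ne_zero hθ.ne' (h1 p)
  exact (continuous_fst.div (by fun_prop) h1).mul (continuous_const.mul (continuous_const.sub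
    (continuous_arctan.comp (Continuous.div (by fun_prop) (by fun_prop) h2))))

theorem continuous_halfAngle {θ : ℝ} (hθ : 0 < sin θ) :
    Continuous fun p : ℝ × ℝ => halfAngle θ p.1 p.2 := by
  unfold halfAngle
  have h2 : ∀ p : ℝ × ℝ, sin θ * √(1 + p.1 ^ 2) ≠ 0 := fun p =>
    mul_ne_zero hθ.ne' (sqrt_one_add_sq_pos p.1).ne'
  exact continuous_const.sub
    (continuous_arctan.comp (Continuous.div (by fun_prop) (by fun_prop) h2))

/-! ### Derivatives, monotonicity, limit and scaling of the arc curvature -/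

theorem div_one_add_sq_lt_pi_div_two_sub_arctan (u : ℝ) :
    u / (1 + u ^ 2) < π / 2 - arctan u := by
  have h1 : 0 < π / 2 - arctan u := by linarith [arctan_lt_pi_div_two u]
  -- For `A = π / 2 - arctan u`, i.e. `u = cot A`, the left side of the claim is `sin A * cos A`, so
  -- the claim is `sin (2 * A) < 2 * A`.
  have h2 := Real.sin_lt (show 0 < 2 * (π / 2 - arctan u) by linarith)
  rw [show 2 * (π / 2 - arctan u) = π - 2 * arctan u by ring, sin_pi_sub, sin_two_mul,
    sin_arctan, cos_arctan] at h2
  have h3 : √(1 + u ^ 2) * √(1 + u ^ 2) = 1 + u ^ 2 := Real.mul_self_sqrt (by positivity)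
  have h4 : 2 * (u / √(1 + u ^ 2)) * (1 / √(1 + u ^ 2)) = 2 * (u / (1 + u ^ 2)) := by
    have := sqrt_one_add_sq_pos u
    rw [mul_assoc, div_mul_div_comm, mul_one, h3]
  linarith

theorem hasDerivAt_sqrt_one_add_sq (x : ℝ) :
    HasDerivAt (fun x : ℝ => √(1 + x ^ 2)) (x / √(1 + x ^ 2)) x := by
  have h : HasDerivAt (fun x : ℝ => 1 + x ^ 2) (2 * x) x := by
    simpa using (hasDerivAt_pow 2 x).const_add 1
  have := h.sqrt (by positivity)
  convert this using 1
  field_simp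

theorem hasDerivAt_div_sqrt_one_add_sq (x : ℝ) :
    HasDerivAt (fun x : ℝ => x / √(1 + x ^ 2)) (1 / √(1 + x ^ 2) ^ 3) x := by
  have hp := sqrt_one_add_sq_pos x
  have h3 : √(1 + x ^ 2) ^ 2 = 1 + x ^ 2 := Real.sq_sqrt (by positivity)
  have := (hasDerivAt_id x).div (hasDerivAt_sqrt_one_add_sq x) hp.ne'
  refine this.congr_deriv ?_
  simp only [id]
  field_simp
  rw [h3]; ring

theorem hasDerivAt_arcCurvature_left {θ : ℝ} (hθ : 0 < sin θ) (x y : ℝ) :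
    HasDerivAt (fun x => arcCurvature θ x y)
      (2 * halfAngle θ x y / √(1 + x ^ 2) ^ 3 -
        2 * x * sin θ * (cos θ - x * y) /
          ((1 + x ^ 2) * (sin θ ^ 2 + x ^ 2 + y ^ 2 + 2 * x * y * cos θ))) x := by
  have hp := sqrt_one_add_sq_pos x
  have h3 : √(1 + x ^ 2) ^ 2 = 1 + x ^ 2 := Real.sq_sqrt (by positivity)
  have hn : HasDerivAt (fun x : ℝ => y + x * cos θ) (cos θ) x := by
    simpa using ((hasDerivAt_id x).mul_const (cos θ)).const_add y
  have hu := (hn.div ((hasDerivAt_sqrt_one_add_sq x).const_mul (sin θ))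
    (mul_pos hθ hp).ne').arctan
  have hA := (hu.const_sub (π / 2)).const_mul 2
  have := (hasDerivAt_div_sqrt_one_add_sq x).mul hA
  unfold arcCurvature halfAngle
  refine this.congr_deriv ?_
  have hN : 0 < sin θ ^ 2 + x ^ 2 + y ^ 2 + 2 * x * y * cos θ := by
    nlinarith [sq_nonneg (y + x * cos θ), sin_sq_add_cos_sq θ, sq_nonneg (x * sin θ), sq_pos_of_pos hθ]
  have e : 1 + ((y + x * cos θ) / (sin θ * √(1 + x ^ 2))) ^ 2 =
      (sin θ ^ 2 + x ^ 2 + y ^ 2 + 2 * x * y * cos θ) / (sin θ ^ 2 * (1 + x ^ 2)) := by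
    rw [div_pow, mul_pow, h3]
    field_simp
    linear_combination x ^ 2 * sin_sq_add_cos_sq θ
  simp only [Pi.div_apply, e]
  set w := √(1 + x ^ 2)
  rw [mul_pow, h3]
  have e2 : cos θ * (sin θ * w) - (y + x * cos θ) * (sin θ * (x / w)) =
      sin θ * (cos θ - x * y) / w := by
    field_simp
    rw [h3]; ring
  rw [e2]
  have e4 : (1 : ℝ) + x ^ 2 ≠ 0 := by positivity
  generalize arctan _ = a
  rw [← h3] at e4 ⊢
  field_simp
  ring

theorem hasDerivAt_arcCurvature_right {θ : ℝ} (hθ : 0 < sin θ) (x y : ℝ) :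
    HasDerivAt (fun x => arcCurvature θ y x)
      (-(2 * y * sin θ / (sin θ ^ 2 + x ^ 2 + y ^ 2 + 2 * x * y * cos θ))) x := by
  have hp := sqrt_one_add_sq_pos y
  have h3 : √(1 + y ^ 2) ^ 2 = 1 + y ^ 2 := Real.sq_sqrt (by positivity)
  have hn : HasDerivAt (fun x : ℝ => x + y * cos θ) 1 x := by
    simpa using (hasDerivAt_id x).add_const (y * cos θ)
  have hu := (hn.div_const (sin θ * √(1 + y ^ 2))).arctan
  have := ((hu.const_sub (π / 2)).const_mul 2).const_mul (y / √(1 + y ^ 2))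
  unfold arcCurvature halfAngle
  refine this.congr_deriv ?_
  have hN : 0 < sin θ ^ 2 + x ^ 2 + y ^ 2 + 2 * x * y * cos θ := by
    nlinarith [sq_nonneg (x + y * cos θ), sin_sq_add_cos_sq θ, sq_nonneg (y * sin θ), sq_pos_of_pos hθ]
  have e : 1 + ((x + y * cos θ) / (sin θ * √(1 + y ^ 2))) ^ 2 =
      (sin θ ^ 2 + x ^ 2 + y ^ 2 + 2 * x * y * cos θ) / (sin θ ^ 2 * (1 + y ^ 2)) := by
    rw [div_pow, mul_pow, h3]
    field_simp
    linear_combination y ^ 2 * sin_sq_add_cos_sq θ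
  rw [e]
  have e4 : (1 : ℝ) + y ^ 2 ≠ 0 := by positivity
  set w := √(1 + y ^ 2)
  rw [← h3] at e4 ⊢
  field_simp

/-- The total curvature of the boundary of a bigon increases with the curvature of a side. -/
theorem arcCurvature_add_swap_lt {θ x x' y : ℝ} (hθ : 0 < sin θ) (hx : 0 < x) (h : x < x') :
    arcCurvature θ x y + arcCurvature θ y x < arcCurvature θ x' y + arcCurvature θ y x' := by
  have hd : ∀ x, HasDerivAt (fun x => arcCurvature θ x y + arcCurvature θ y x) _ x := fun x =>
    (hasDerivAt_arcCurvature_left hθ x y).add (hasDerivAt_arcCurvature_right hθ x y)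
  refine strictMonoOn_of_deriv_pos (convex_Ici 0) (fun z _ => (hd z).continuousAt.continuousWithinAt)
    (fun z hz => ?_) hx.le (hx.trans h).le h
  rw [interior_Ici] at hz
  rw [(hd z).deriv]
  have hp := sqrt_one_add_sq_pos z
  have h3 : √(1 + z ^ 2) ^ 2 = 1 + z ^ 2 := Real.sq_sqrt (by positivity)
  have hN : 0 < sin θ ^ 2 + z ^ 2 + y ^ 2 + 2 * z * y * cos θ := by
    nlinarith [sq_nonneg (y + z * cos θ), sin_sq_add_cos_sq θ, sq_nonneg (z * sin θ), sq_pos_of_pos hθ]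
  have hA := div_one_add_sq_lt_pi_div_two_sub_arctan ((y + z * cos θ) / (sin θ * √(1 + z ^ 2)))
  have e : 1 + ((y + z * cos θ) / (sin θ * √(1 + z ^ 2))) ^ 2 =
      (sin θ ^ 2 + z ^ 2 + y ^ 2 + 2 * z * y * cos θ) / (sin θ ^ 2 * (1 + z ^ 2)) := by
    rw [div_pow, mul_pow, h3]
    field_simp
    linear_combination z ^ 2 * sin_sq_add_cos_sq θ
  rw [e] at hA
  change _ < halfAngle θ z y at hA
  -- With `u` the cotangent of the half-angle `A`, the derivative of the sum is a positive factor
  -- times `A - u / (1 + u ^ 2)`.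
  have key : 2 * halfAngle θ z y / √(1 + z ^ 2) ^ 3 -
        2 * z * sin θ * (cos θ - z * y) /
          ((1 + z ^ 2) * (sin θ ^ 2 + z ^ 2 + y ^ 2 + 2 * z * y * cos θ)) +
      -(2 * y * sin θ / (sin θ ^ 2 + z ^ 2 + y ^ 2 + 2 * z * y * cos θ)) =
      2 / √(1 + z ^ 2) ^ 3 * (halfAngle θ z y - (y + z * cos θ) / (sin θ * √(1 + z ^ 2)) /
        ((sin θ ^ 2 + z ^ 2 + y ^ 2 + 2 * z * y * cos θ) / (sin θ ^ 2 * (1 + z ^ 2)))) := by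
    generalize halfAngle θ z y = A
    have e4 : (1 : ℝ) + z ^ 2 ≠ 0 := by positivity
    generalize sin θ ^ 2 + z ^ 2 + y ^ 2 + 2 * z * y * cos θ = N at *
    have h4 : (1 : ℝ) + z ^ 2 = √(1 + z ^ 2) ^ 2 := h3.symm
    have h5 : z ^ 2 = √(1 + z ^ 2) ^ 2 - 1 := by linarith
    generalize √(1 + z ^ 2) = w at *
    rw [h4]
    field_simp
    linear_combination (w * y * sin θ) * h5
  rw [key]
  exact mul_pos (by positivity) (sub_pos.2 hA)

/-- The sum over the bigon grows while the arc on the other circle loses curvature, so this arc must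
gain. -/
theorem arcCurvature_lt_arcCurvature_left {θ x x' y : ℝ} (hθ : 0 < sin θ) (hx : 0 < x)
    (hy : 0 < y) (h : x < x') : arcCurvature θ x y < arcCurvature θ x' y := by
  have h1 := arcCurvature_add_swap_lt (y := y) hθ hx h
  have h2 := arcCurvature_lt_of_lt hθ hy h
  linarith

theorem arcCurvature_add_swap_le {θ x x' y y' : ℝ} (hθ : 0 < sin θ) (hx : 0 < x) (hy : 0 < y)
    (hxx : x ≤ x') (hyy : y ≤ y') :
    arcCurvature θ x y + arcCurvature θ y x ≤ arcCurvature θ x' y' + arcCurvature θ y' x' := by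
  have h1 : arcCurvature θ x y + arcCurvature θ y x ≤
      arcCurvature θ x' y + arcCurvature θ y x' := by
    rcases hxx.eq_or_lt with rfl | h
    · rfl
    · exact (arcCurvature_add_swap_lt hθ hx h).le
  have h2 : arcCurvature θ y x' + arcCurvature θ x' y ≤
      arcCurvature θ y' x' + arcCurvature θ x' y' := by
    rcases hyy.eq_or_lt with rfl | h
    · rfl
    · exact (arcCurvature_add_swap_lt hθ hy h).le
  linarith

/-- A very small disk sees the other circle as a straight line, so the half-angle tends to `θ`,
while the cosine `x / √(1 + x ^ 2)` of the radius tends to `1`. This is where the bound `2 * Θ e` of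
the admissible set comes from. -/
theorem tendsto_arcCurvature_atTop {θ : ℝ} (hθ : θ ∈ Set.Ioc 0 (π / 2)) (y : ℝ) :
    Tendsto (fun x => arcCurvature θ x y) atTop (𝓝 (2 * θ)) := by
  have hs : 0 < sin θ := sin_pos_of_pos_of_lt_pi hθ.1 (by linarith [hθ.2, pi_pos])
  have hinv : Tendsto (fun x : ℝ => (√(1 + x ^ 2))⁻¹) atTop (𝓝 0) := by
    refine tendsto_inv_atTop_zero.comp (tendsto_sqrt_atTop.comp ?_)
    exact tendsto_atTop_add_const_left _ _ (tendsto_pow_atTop two_ne_zero)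
  have hone : Tendsto (fun x : ℝ => x / √(1 + x ^ 2)) atTop (𝓝 1) := by
    have h1 : Tendsto (fun x : ℝ => √(1 - ((√(1 + x ^ 2))⁻¹) ^ 2)) atTop (𝓝 (√(1 - 0 ^ 2))) :=
      ((continuous_const.sub (continuous_id.pow 2)).sqrt.tendsto (0 : ℝ)).comp hinv
    simp only [ne_eq, OfNat.ofNat_ne_zero, not_false_eq_true, zero_pow, sub_zero,
      Real.sqrt_one] at h1
    refine h1.congr' ?_
    filter_upwards [eventually_ge_atTop 0] with x hx
    have hp := sqrt_one_add_sq_pos x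
    have h3 : √(1 + x ^ 2) ^ 2 = 1 + x ^ 2 := Real.sq_sqrt (by positivity)
    have h4 : 1 - (√(1 + x ^ 2))⁻¹ ^ 2 = (x / √(1 + x ^ 2)) ^ 2 := by
      rw [div_pow, inv_pow, h3]; field_simp; ring
    rw [h4, Real.sqrt_sq (by positivity)]
  have hu : Tendsto (fun x : ℝ => (y + x * cos θ) / (sin θ * √(1 + x ^ 2))) atTop
      (𝓝 (y / sin θ * 0 + cos θ / sin θ * 1)) := by
    refine ((hinv.const_mul (y / sin θ)).add (hone.const_mul (cos θ / sin θ))).congr fun x => ?_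
    have hp := sqrt_one_add_sq_pos x
    field_simp
  have ha : arctan (y / sin θ * 0 + cos θ / sin θ * 1) = π / 2 - θ := by
    rw [mul_zero, zero_add, mul_one, ← inv_div, ← tan_eq_sin_div_cos, ← tan_pi_div_two_sub,
      arctan_tan (by linarith [hθ.2, pi_pos]) (by linarith [hθ.1])]
  have := hone.mul ((((continuous_arctan.tendsto _).comp hu).const_sub (π / 2)).const_mul 2)
  rw [ha] at this
  rw [show 1 * (2 * (π / 2 - (π / 2 - θ))) = 2 * θ by ring] at this
  exact this

theorem arcCurvature_le_arcCurvature_mul {θ x y s : ℝ} (hθ : θ ∈ Set.Ioc 0 (π / 2)) (hx : 0 < x)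
    (hs : 1 ≤ s) : arcCurvature θ x y ≤ arcCurvature θ (s * x) (s * y) := by
  have hsin : 0 < sin θ := sin_pos_of_pos_of_lt_pi hθ.1 (by linarith [hθ.2, pi_pos])
  -- The number `a` is invariant under scaling, so only the cosine `c` of the radius changes; it
  -- increases with `s`, and `c * (π / 2 - arctan (a * c))` increases with `c`.
  set a := (y / x + cos θ) / sin θ with ha
  have e : ∀ s : ℝ, 0 < s → arcCurvature θ (s * x) (s * y) =
      2 * ((s * x / √(1 + (s * x) ^ 2)) * (π / 2 - arctan (a * (s * x / √(1 + (s * x) ^ 2))))) := by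
    intro s hs
    have hp := sqrt_one_add_sq_pos (s * x)
    have : (s * y + s * x * cos θ) / (sin θ * √(1 + (s * x) ^ 2)) =
        a * (s * x / √(1 + (s * x) ^ 2)) := by
      rw [ha]; field_simp
    rw [arcCurvature, halfAngle, this]; ring
  have hmono : StrictMono fun c : ℝ => c * (π / 2 - arctan (a * c)) := by
    have hd : ∀ c : ℝ, HasDerivAt (fun c : ℝ => c * (π / 2 - arctan (a * c)))
        (1 * (π / 2 - arctan (a * c)) + c * -(1 / (1 + (a * c) ^ 2) * (a * 1))) c := fun c =>
      (hasDerivAt_id c).mul ((((hasDerivAt_id c).const_mul a).arctan).const_sub (π / 2))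
    refine strictMono_of_deriv_pos fun c => ?_
    rw [(hd c).deriv]
    have := div_one_add_sq_lt_pi_div_two_sub_arctan (a * c)
    have e : c * -(1 / (1 + (a * c) ^ 2) * (a * 1)) = -(a * c / (1 + (a * c) ^ 2)) := by ring
    rw [e]; linarith
  have hmono' : StrictMono fun x : ℝ => x / √(1 + x ^ 2) := by
    refine strictMono_of_deriv_pos fun c => ?_
    rw [(hasDerivAt_div_sqrt_one_add_sq c).deriv]
    have := sqrt_one_add_sq_pos c
    positivity
  have e1 := e 1 one_pos
  rw [one_mul, one_mul] at e1
  rw [e1, e s (by linarith)]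
  have := hmono.monotone (hmono'.monotone (show x ≤ s * x by nlinarith))
  linarith

/-! ### Total curvatures as functions of the geodesic curvatures -/

theorem sin_pos_of_mem_Ioc {θ : ℝ} (hθ : θ ∈ Set.Ioc 0 (π / 2)) : 0 < sin θ :=
  sin_pos_of_pos_of_lt_pi hθ.1 (by linarith [hθ.2, pi_pos])

namespace SurfaceGraph

variable {Dart : Type*} [Fintype Dart] (M : SurfaceGraph Dart) (Θ : M.Edge → ℝ)

theorem edge_opp {Dart : Type*} (M : SurfaceGraph Dart) (d : Dart) : M.edge (M.opp d) = M.edge d :=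
  Quotient.sound (Equiv.Perm.sameCycle_apply_left.2 (Equiv.Perm.SameCycle.refl _ _))

theorem edge_eq_iff {Dart : Type*} (M : SurfaceGraph Dart) {d d' : Dart} :
    M.edge d' = M.edge d ↔ d' = d ∨ d' = M.opp d := by
  constructor
  · intro h
    obtain ⟨i, hi⟩ : M.opp.SameCycle d d' := (Quotient.exact h : M.opp.SameCycle d' d).symm
    have h2 : M.opp ^ (2 : ℤ) = 1 := by
      ext x; rw [zpow_two]; simp [M.opp_opp]
    rcases Int.even_or_odd' i with ⟨j, rfl | rfl⟩
    · left; rw [zpow_mul, h2] at hi; simpa using hi.symm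
    · right; rw [zpow_add, zpow_mul, h2] at hi; simpa using hi.symm
  · rintro (rfl | rfl)
    · rfl
    · exact M.edge_opp d

/-- Total geodesic curvature of the arc of a dart, for given geodesic curvatures of the circles. -/
def dartCurvature {Dart : Type*} (M : SurfaceGraph Dart) (Θ : M.Edge → ℝ) (k : M.Face → ℝ)
    (d : Dart) : ℝ :=
  arcCurvature (Θ (M.edge d)) (k (M.face d)) (k (M.face (M.opp d)))

open Classical in
/-- Total geodesic curvature of the circle of a face, for given geodesic curvatures. -/
def faceCurvature (k : M.Face → ℝ) (f : M.Face) : ℝ :=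
  ∑ d, if M.face d = f then M.dartCurvature Θ k d else 0

open Classical in
/-- The contribution of the edge of `d` to the total curvature of the faces in `F'`. -/
def edgeCurvature {Dart : Type*} (M : SurfaceGraph Dart) (Θ : M.Edge → ℝ) (k : M.Face → ℝ)
    (F' : Finset M.Face) (d : Dart) : ℝ :=
  (if M.face d ∈ F' then arcCurvature (Θ (M.edge d)) (k (M.face d)) (k (M.face (M.opp d))) else 0) +
  if M.face (M.opp d) ∈ F' then
    arcCurvature (Θ (M.edge d)) (k (M.face (M.opp d))) (k (M.face d)) else 0

theorem two_mul_sum_faceCurvature (k : M.Face → ℝ) (F' : Finset M.Face) :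
    2 * ∑ f ∈ F', M.faceCurvature Θ k f = ∑ d, M.edgeCurvature Θ k F' d := by
  classical
  have h1 : ∑ f ∈ F', M.faceCurvature Θ k f =
      ∑ d, if M.face d ∈ F' then M.dartCurvature Θ k d else 0 := by
    unfold faceCurvature
    rw [Finset.sum_comm]
    refine Finset.sum_congr rfl fun d _ => ?_
    rw [Finset.sum_ite_eq]
  have h2 : ∑ f ∈ F', M.faceCurvature Θ k f =
      ∑ d, if M.face (M.opp d) ∈ F' then M.dartCurvature Θ k (M.opp d) else 0 :=
    h1.trans (Equiv.sum_comp M.opp fun d =>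
      if M.face d ∈ F' then M.dartCurvature Θ k d else 0).symm
  rw [two_mul]
  nth_rewrite 1 [h1]
  rw [h2, ← Finset.sum_add_distrib]
  refine Finset.sum_congr rfl fun d _ => ?_
  simp only [dartCurvature, edgeCurvature, edge_opp, M.opp_opp]

theorem sum_edgesOf (F' : Finset M.Face) [DecidablePred fun d => M.face d ∈ F' ∨
    M.face (M.opp d) ∈ F'] :
    2 * ∑ e ∈ M.edgesOf F', 2 * Θ e =
      ∑ d, if M.face d ∈ F' ∨ M.face (M.opp d) ∈ F' then 2 * Θ (M.edge d) else 0 := by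
  classical
  have hmem : ∀ d, M.edge d ∈ M.edgesOf F' ↔ (M.face d ∈ F' ∨ M.face (M.opp d) ∈ F') := by
    intro d
    simp only [edgesOf, Finset.mem_filter, Finset.mem_univ, true_and]
    constructor
    · rintro ⟨d', h, h'⟩
      rcases M.edge_eq_iff.1 h with rfl | rfl
      · exact Or.inl h'
      · exact Or.inr h'
    · rintro (h | h)
      · exact ⟨d, rfl, h⟩
      · exact ⟨_, M.edge_opp d, h⟩
  have hcard : ∀ e : M.Edge, ((Finset.univ.filter fun d => M.edge d = e).card : ℝ) = 2 := by
    intro e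
    obtain ⟨d, rfl⟩ : ∃ d, M.edge d = e := Quotient.exists_rep e
    have : (Finset.univ.filter fun d' => M.edge d' = M.edge d) = {d, M.opp d} := by
      ext d'; simp [M.edge_eq_iff]
    rw [this, Finset.card_pair (M.opp_ne d).symm]; norm_num
  simp_rw [← hmem]
  rw [← Finset.sum_fiberwise (s := Finset.univ) (g := M.edge), Finset.mul_sum,
    ← Finset.sum_filter_add_sum_filter_not Finset.univ (fun e => e ∈ M.edgesOf F')]
  rw [Finset.sum_eq_zero (s := Finset.univ.filter fun e => e ∉ M.edgesOf F'), add_zero]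
  · rw [Finset.filter_mem_eq_inter, Finset.univ_inter]
    refine Finset.sum_congr rfl fun e he => ?_
    rw [Finset.sum_congr rfl (g := fun _ => 2 * Θ e), Finset.sum_const, nsmul_eq_mul, hcard]
    intro d hd
    rw [Finset.mem_filter] at hd
    rw [hd.2, if_pos he]
  · intro e he
    refine Finset.sum_eq_zero fun d hd => ?_
    rw [Finset.mem_filter] at hd he
    rw [hd.2, if_neg he.2]

variable {M Θ}

/-- Raising the geodesic curvatures exactly on `F'` raises the total curvature of `F'`. -/
theorem sum_faceCurvature_lt (hΘ : ∀ e, Θ e ∈ Set.Ioc 0 (π / 2)) {k k' : M.Face → ℝ}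
    (hk : ∀ f, 0 < k f) (hk' : ∀ f, 0 < k' f) {F' : Finset M.Face} (hF : F'.Nonempty)
    (hin : ∀ f ∈ F', k f < k' f) (hout : ∀ f ∉ F', k' f ≤ k f) :
    ∑ f ∈ F', M.faceCurvature Θ k f < ∑ f ∈ F', M.faceCurvature Θ k' f := by
  classical
  have key : ∀ d, M.face d ∈ F' → M.edgeCurvature Θ k F' d < M.edgeCurvature Θ k' F' d := by
    intro d hd
    have hs := sin_pos_of_mem_Ioc (hΘ (M.edge d))
    simp only [edgeCurvature, if_pos hd]
    by_cases hd' : M.face (M.opp d) ∈ F'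
    · simp only [if_pos hd']
      refine (arcCurvature_add_swap_lt hs (hk _) (hin _ hd)).trans_le ?_
      exact arcCurvature_add_swap_le hs (hk' _) (hk _) le_rfl (hin _ hd').le
    · simp only [if_neg hd', add_zero]
      refine (arcCurvature_lt_arcCurvature_left hs (hk _) (hk _) (hin _ hd)).trans_le ?_
      exact arcCurvature_le_of_le hs (hk' _) (hout _ hd')
  -- An edge may meet `F'` only on the side of `opp d`; symmetry reduces that case to `key`.
  have hsymm : ∀ (k : M.Face → ℝ) d,
      M.edgeCurvature Θ k F' (M.opp d) = M.edgeCurvature Θ k F' d := by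
    intro k d
    simp only [edgeCurvature, edge_opp, M.opp_opp]
    rw [add_comm]
  have h2 : 2 * ∑ f ∈ F', M.faceCurvature Θ k f < 2 * ∑ f ∈ F', M.faceCurvature Θ k' f := by
    rw [two_mul_sum_faceCurvature, two_mul_sum_faceCurvature]
    obtain ⟨f, hf⟩ := hF
    obtain ⟨d, rfl⟩ : ∃ d, M.face d = f := Quotient.exists_rep f
    refine Finset.sum_lt_sum (fun d' _ => ?_) ⟨d, Finset.mem_univ _, key d hf⟩
    by_cases h : M.face d' ∈ F'
    · exact (key d' h).le
    by_cases h' : M.face (M.opp d') ∈ F'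
    · rw [← hsymm k, ← hsymm k']
      exact (key _ h').le
    · simp [edgeCurvature, h, h']
  linarith

/-- If the set where `k' < k` were nonempty, the maximum principle on it would give `k` the larger
total there, against `h`. -/
theorem le_of_faceCurvature_le (hΘ : ∀ e, Θ e ∈ Set.Ioc 0 (π / 2)) {k k' : M.Face → ℝ}
    (hk : ∀ f, 0 < k f) (hk' : ∀ f, 0 < k' f) (h : M.faceCurvature Θ k ≤ M.faceCurvature Θ k') :
    k ≤ k' := by
  classical
  by_contra hne
  simp only [Pi.le_def, not_forall, not_le] at hne
  obtain ⟨f, hf⟩ := hne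
  have := sum_faceCurvature_lt hΘ hk' hk (F' := Finset.univ.filter fun f => k' f < k f)
    ⟨f, by simpa using hf⟩ (by simp) (by simp)
  exact absurd this (not_lt.2 (Finset.sum_le_sum fun f _ => h f))

theorem faceCurvature_injective (hΘ : ∀ e, Θ e ∈ Set.Ioc 0 (π / 2)) {k k' : M.Face → ℝ}
    (hk : ∀ f, 0 < k f) (hk' : ∀ f, 0 < k' f) (h : M.faceCurvature Θ k = M.faceCurvature Θ k') :
    k = k' :=
  le_antisymm (le_of_faceCurvature_le hΘ hk hk' h.le) (le_of_faceCurvature_le hΘ hk' hk h.ge)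

theorem update_pos {ι : Type*} [DecidableEq ι] {k : ι → ℝ} (hk : ∀ f, 0 < k f) (f : ι) {x : ℝ}
    (hx : 0 < x) (g : ι) : 0 < Function.update k f x g := by
  by_cases h : g = f
  · subst h; simpa using hx
  · simpa [h] using hk g

open Classical in
theorem faceCurvature_update_lt (hΘ : ∀ e, Θ e ∈ Set.Ioc 0 (π / 2)) {k : M.Face → ℝ}
    (hk : ∀ f, 0 < k f) (f : M.Face) {x x' : ℝ} (hx : 0 < x) (h : x < x') :
    M.faceCurvature Θ (Function.update k f x) f < M.faceCurvature Θ (Function.update k f x') f := by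
  have := sum_faceCurvature_lt hΘ (update_pos hk f hx) (update_pos hk f (hx.trans h))
    (F' := {f}) (Finset.singleton_nonempty f) (by simpa using h)
    (by intro g hg; rw [Finset.mem_singleton] at hg; simp [hg])
  simpa using this

theorem faceCurvature_le_of_le (hΘ : ∀ e, Θ e ∈ Set.Ioc 0 (π / 2)) {k k' : M.Face → ℝ}
    (hk : ∀ f, 0 < k f) (h : k ≤ k') {f : M.Face} (hf : k f = k' f) :
    M.faceCurvature Θ k' f ≤ M.faceCurvature Θ k f := by
  refine Finset.sum_le_sum fun d _ => ?_
  split_ifs with hd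
  · subst hd
    rw [dartCurvature, dartCurvature, ← hf]
    exact arcCurvature_le_of_le (sin_pos_of_mem_Ioc (hΘ _)) (hk _) (h _)
  · rfl

theorem faceCurvature_le_mul (hΘ : ∀ e, Θ e ∈ Set.Ioc 0 (π / 2)) {k : M.Face → ℝ}
    (hk : ∀ f, 0 < k f) (f : M.Face) :
    M.faceCurvature Θ k f ≤ k f * (π * Fintype.card Dart) := by
  have : M.faceCurvature Θ k f ≤ ∑ _d : Dart, k f * π := by
    refine Finset.sum_le_sum fun d _ => ?_
    split_ifs with hd
    · subst hd
      exact arcCurvature_le_mul (hΘ _) (hk _) (hk _)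
    · have := hk f; positivity
  refine this.trans_eq ?_
  rw [Finset.sum_const, nsmul_eq_mul, Finset.card_univ]; ring

theorem faceCurvature_le_smul (hΘ : ∀ e, Θ e ∈ Set.Ioc 0 (π / 2)) {k : M.Face → ℝ}
    (hk : ∀ f, 0 < k f) {s : ℝ} (hs : 1 ≤ s) :
    M.faceCurvature Θ k ≤ M.faceCurvature Θ (s • k) := by
  refine fun f => Finset.sum_le_sum fun d _ => ?_
  split_ifs with hd
  · exact arcCurvature_le_arcCurvature_mul (hΘ _) (hk _) hs
  · rfl

theorem continuous_faceCurvature (hΘ : ∀ e, Θ e ∈ Set.Ioc 0 (π / 2)) (f : M.Face) :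
    Continuous fun k => M.faceCurvature Θ k f := by
  refine continuous_finsetSum _ fun d _ => ?_
  split_ifs
  · have h : Continuous fun k : M.Face → ℝ => (k (M.face d), k (M.face (M.opp d))) := by fun_prop
    exact (continuous_arcCurvature (sin_pos_of_mem_Ioc (hΘ (M.edge d)))).comp h
  · exact continuous_const

/-- Large geodesic curvatures on `F'` alone give total curvatures that are too large. -/
theorem exists_sum_lt_sum_faceCurvature (hΘ : ∀ e, Θ e ∈ Set.Ioc 0 (π / 2)) {T : M.Face → ℝ}
    (hT : T ∈ M.admissible Θ) {F' : Finset M.Face} (hF : F'.Nonempty) (Y : ℝ) :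
    ∃ X : ℝ, ∀ k : M.Face → ℝ, (∀ f, 0 < k f) → (∀ f ∈ F', X ≤ k f) → (∀ f ∉ F', k f ≤ Y) →
      ∑ f ∈ F', T f < ∑ f ∈ F', M.faceCurvature Θ k f := by
  classical
  -- The cutoff `1` serves the edges with both sides in `F'`, where one of the two curvatures is
  -- only used through `1 ≤ X`.
  set Z := max Y 1
  have hlim : Tendsto (fun X => ∑ d, if M.face d ∈ F' ∨ M.face (M.opp d) ∈ F' then
      arcCurvature (Θ (M.edge d)) X Z else 0) atTop (𝓝 (2 * ∑ e ∈ M.edgesOf F', 2 * Θ e)) := by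
    rw [sum_edgesOf]
    refine tendsto_finsetSum _ fun d _ => ?_
    split_ifs
    · exact tendsto_arcCurvature_atTop (hΘ _) Z
    · exact tendsto_const_nhds
  have hlt : 2 * ∑ f ∈ F', T f < 2 * ∑ e ∈ M.edgesOf F', 2 * Θ e := by
    linarith [hT.2 F' hF]
  obtain ⟨X, hX, hX1⟩ := ((hlim.eventually (lt_mem_nhds hlt)).and (eventually_ge_atTop 1)).exists
  refine ⟨X, fun k hk hin hout => ?_⟩
  suffices h : 2 * ∑ f ∈ F', T f < 2 * ∑ f ∈ F', M.faceCurvature Θ k f by linarith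
  refine hX.trans_le ?_
  rw [two_mul_sum_faceCurvature]
  refine Finset.sum_le_sum fun d _ => ?_
  have hs := sin_pos_of_mem_Ioc (hΘ (M.edge d))
  have hX0 : 0 < X := by linarith
  have bd : ∀ x y, X ≤ x → 0 < y → y ≤ Y →
      arcCurvature (Θ (M.edge d)) X Z ≤ arcCurvature (Θ (M.edge d)) x y := by
    intro x y hx hy hyY
    refine (arcCurvature_le_of_le hs hX0 (hyY.trans (le_max_left _ _))).trans ?_
    rcases hx.eq_or_lt with rfl | hx
    · rfl
    · exact (arcCurvature_lt_arcCurvature_left hs hX0 hy hx).le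
  unfold edgeCurvature
  by_cases h1 : M.face d ∈ F' <;> by_cases h2 : M.face (M.opp d) ∈ F' <;>
    simp only [h1, h2, if_true, if_false, or_true, true_or, or_self, add_zero, zero_add]
  -- With both sides in `F'`, the bigon has at least the total it has for curvatures `X` and `1`;
  -- dropping the arc on the second circle leaves a term at least `arcCurvature _ X Z`.
  · refine le_trans ?_ (arcCurvature_add_swap_le hs hX0 one_pos (hin _ h1) (hX1.trans (hin _ h2)))
    have h3 := arcCurvature_pos (Θ (M.edge d)) X one_pos
    have h4 := arcCurvature_le_of_le hs hX0 (le_max_right Y 1)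
    linarith
  · exact bd _ _ (hin _ h1) (hk _) (hout _ h2)
  · exact bd _ _ (hin _ h2) (hk _) (hout _ h1)
  · exact le_rfl

/-! ### Thurston's algorithm for geodesic curvatures -/

-- The intermediate value theorem applies: a small curvature gives too little by the linear bound,
-- and a large one too much by admissibility for the single face `f`.
open Classical in
theorem exists_faceCurvature_update_eq (hΘ : ∀ e, Θ e ∈ Set.Ioc 0 (π / 2)) {T : M.Face → ℝ}
    (hT : T ∈ M.admissible Θ) {k : M.Face → ℝ} (hk : ∀ f, 0 < k f) (f : M.Face) :
    ∃ x, 0 < x ∧ M.faceCurvature Θ (Function.update k f x) f = T f := by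
  obtain ⟨Y, hY⟩ := Finite.bddAbove_range k
  obtain ⟨X, hX⟩ := exists_sum_lt_sum_faceCurvature hΘ hT (Finset.singleton_nonempty f) Y
  set C := π * Fintype.card Dart with hC
  have hC0 : 0 ≤ C := by positivity
  set x₀ := min (T f / (C + 1)) 1
  have hT0 := hT.1 f
  have hx₀ : 0 < x₀ := lt_min (by positivity) one_pos
  set x₁ := max X x₀
  have hx₁ : 0 < x₁ := hx₀.trans_le (le_max_right _ _)
  have h0 : M.faceCurvature Θ (Function.update k f x₀) f ≤ T f := by
    refine (faceCurvature_le_mul hΘ (update_pos hk f hx₀) f).trans ?_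
    rw [Function.update_self, ← hC]
    have h1 : x₀ ≤ T f / (C + 1) := min_le_left _ _
    rw [le_div_iff₀ (by positivity)] at h1
    linarith
  have h1 : T f ≤ M.faceCurvature Θ (Function.update k f x₁) f := by
    have := hX (Function.update k f x₁) (update_pos hk f hx₁)
      (by intro g hg; rw [Finset.mem_singleton] at hg; subst hg; rw [Function.update_self]; exact le_max_left _ _)
      (by
        intro g hg
        rw [Finset.mem_singleton] at hg
        simpa [hg] using hY (Set.mem_range_self g))
    simpa using this.le
  have hcont : Continuous fun x => M.faceCurvature Θ (Function.update k f x) f :=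
    (continuous_faceCurvature hΘ f).comp (continuous_const.update f continuous_id)
  obtain ⟨x, hx, hxe⟩ := intermediate_value_Icc (le_max_right X x₀) hcont.continuousOn ⟨h0, h1⟩
  exact ⟨x, hx₀.trans_le hx.1, hxe⟩

open Classical in
variable (M Θ) in
/-- `k'` arises from `k` by adjusting each geodesic curvature separately. -/
def CurvatureStep (T k k' : M.Face → ℝ) : Prop :=
  (∀ f, 0 < k' f) ∧ ∀ f, M.faceCurvature Θ (Function.update k f (k' f)) f = T f

variable {T : M.Face → ℝ}

theorem exists_curvatureStep (hΘ : ∀ e, Θ e ∈ Set.Ioc 0 (π / 2)) (hT : T ∈ M.admissible Θ)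
    {k : M.Face → ℝ} (hk : ∀ f, 0 < k f) : ∃ k', M.CurvatureStep Θ T k k' := by
  choose k' h using exists_faceCurvature_update_eq hΘ hT hk
  exact ⟨k', fun f => (h f).1, fun f => (h f).2⟩

theorem exists_curvatureSeq (hΘ : ∀ e, Θ e ∈ Set.Ioc 0 (π / 2)) (hT : T ∈ M.admissible Θ)
    {k₀ : M.Face → ℝ} (hk : ∀ f, 0 < k₀ f) :
    ∃ k : ℕ → M.Face → ℝ, k 0 = k₀ ∧ ∀ m, M.CurvatureStep Θ T (k m) (k (m + 1)) := by
  -- The recursion runs on positive vectors, since a step is only available from those.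
  choose φ hφ using fun k : {k : M.Face → ℝ // ∀ f, 0 < k f} => exists_curvatureStep hΘ hT k.2
  let u : ℕ → {k : M.Face → ℝ // ∀ f, 0 < k f} :=
    fun m => Nat.rec ⟨k₀, hk⟩ (fun _ k => ⟨φ k, (hφ k).1⟩) m
  exact ⟨fun m => (u m).1, rfl, fun m => hφ (u m)⟩

/-- Higher neighbours lower the total curvature of `f`, so `f` needs a higher curvature of its own
to reach the same target. -/
theorem CurvatureStep.mono (hΘ : ∀ e, Θ e ∈ Set.Ioc 0 (π / 2)) {k k' l l' : M.Face → ℝ}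
    (hk : ∀ f, 0 < k f) (h : M.CurvatureStep Θ T k k') (h' : M.CurvatureStep Θ T l l')
    (hkl : k ≤ l) : k' ≤ l' := by
  classical
  intro f
  by_contra! hlt
  have h1 := faceCurvature_update_lt hΘ hk f (h'.1 f) hlt
  have h2 := faceCurvature_le_of_le hΘ (update_pos hk f (h'.1 f))
    (update_le_update_iff.2 ⟨le_refl (l' f), fun g _ => hkl g⟩) (f := f) (by simp)
  have h3 := h.2 f
  have h4 := h'.2 f
  linarith

theorem CurvatureStep.le (hΘ : ∀ e, Θ e ∈ Set.Ioc 0 (π / 2)) {k k' : M.Face → ℝ}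
    (hk : ∀ f, 0 < k f) (h : M.CurvatureStep Θ T k k') (hT : M.faceCurvature Θ k ≤ T) :
    k ≤ k' ∧ M.faceCurvature Θ k' ≤ T := by
  classical
  have hle : k ≤ k' := by
    intro f
    by_contra! hlt
    have h1 := faceCurvature_update_lt hΘ hk f (h.1 f) hlt
    rw [Function.update_eq_self, h.2] at h1
    exact absurd (hT f) (not_le.2 h1)
  refine ⟨hle, fun f => ?_⟩
  -- At `f` the target is met exactly while the neighbours still have their old curvatures; raising
  -- them to the new ones can only lower the total.
  rw [← h.2 f]
  refine faceCurvature_le_of_le hΘ (update_pos hk f (h.1 f)) ?_ (by simp)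
  exact update_le_iff.2 ⟨le_rfl, fun g _ => hle g⟩

theorem CurvatureStep.ge (hΘ : ∀ e, Θ e ∈ Set.Ioc 0 (π / 2)) {k k' : M.Face → ℝ}
    (hk : ∀ f, 0 < k f) (h : M.CurvatureStep Θ T k k') (hT : T ≤ M.faceCurvature Θ k) :
    k' ≤ k ∧ T ≤ M.faceCurvature Θ k' := by
  classical
  have hle : k' ≤ k := by
    intro f
    by_contra! hlt
    have h1 := faceCurvature_update_lt hΘ hk f (hk f) hlt
    rw [Function.update_eq_self, h.2] at h1
    exact absurd (hT f) (not_le.2 h1)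
  refine ⟨hle, fun f => ?_⟩
  rw [← h.2 f]
  refine faceCurvature_le_of_le hΘ h.1 ?_ (by simp)
  exact le_update_iff.2 ⟨le_rfl, fun g _ => hle g⟩

/-! ### Orbits of the step: bounds and limits -/

section Sequence

variable {k : ℕ → M.Face → ℝ}

theorem curvatureSeq_pos (h0 : ∀ f, 0 < k 0 f) (hs : ∀ m, M.CurvatureStep Θ T (k m) (k (m + 1)))
    (m : ℕ) (f : M.Face) : 0 < k m f := by
  cases m with
  | zero => exact h0 f
  | succ m => exact (hs m).1 f

theorem curvatureSeq_monotone (hΘ : ∀ e, Θ e ∈ Set.Ioc 0 (π / 2)) (h0 : ∀ f, 0 < k 0 f)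
    (hs : ∀ m, M.CurvatureStep Θ T (k m) (k (m + 1))) (hT : M.faceCurvature Θ (k 0) ≤ T) :
    Monotone k ∧ ∀ m, M.faceCurvature Θ (k m) ≤ T := by
  have h : ∀ m, M.faceCurvature Θ (k m) ≤ T := fun m => by
    induction m with
    | zero => exact hT
    | succ m ih => exact ((hs m).le hΘ (curvatureSeq_pos h0 hs m) ih).2
  exact ⟨monotone_nat_of_le_succ fun m => ((hs m).le hΘ (curvatureSeq_pos h0 hs m) (h m)).1, h⟩

theorem curvatureSeq_antitone (hΘ : ∀ e, Θ e ∈ Set.Ioc 0 (π / 2)) (h0 : ∀ f, 0 < k 0 f)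
    (hs : ∀ m, M.CurvatureStep Θ T (k m) (k (m + 1))) (hT : T ≤ M.faceCurvature Θ (k 0)) :
    Antitone k ∧ ∀ m, T ≤ M.faceCurvature Θ (k m) := by
  have h : ∀ m, T ≤ M.faceCurvature Θ (k m) := fun m => by
    induction m with
    | zero => exact hT
    | succ m ih => exact ((hs m).ge hΘ (curvatureSeq_pos h0 hs m) ih).2
  exact ⟨antitone_nat_of_succ_le fun m => ((hs m).ge hΘ (curvatureSeq_pos h0 hs m) (h m)).1, h⟩

/-- The vectors that mix step `m` with the new entry at `f` have the same limit `l`, so the defining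
equation of the step passes to it. -/
theorem faceCurvature_eq_of_tendsto (hΘ : ∀ e, Θ e ∈ Set.Ioc 0 (π / 2))
    (hs : ∀ m, M.CurvatureStep Θ T (k m) (k (m + 1))) {l : M.Face → ℝ}
    (hl : Tendsto k atTop (𝓝 l)) : M.faceCurvature Θ l = T := by
  classical
  funext f
  have h1 : Tendsto (fun m => Function.update (k m) f (k (m + 1) f)) atTop
      (𝓝 (Function.update l f (l f))) :=
    hl.update f ((tendsto_pi_nhds.1 hl f).comp (tendsto_add_atTop_nat 1))
  rw [Function.update_eq_self] at h1
  have h2 := ((continuous_faceCurvature hΘ f).tendsto l).comp h1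
  refine tendsto_nhds_unique h2 (tendsto_const_nhds.congr fun m => ((hs m).2 f).symm)

theorem curvatureSeq_tendsto_of_le (hΘ : ∀ e, Θ e ∈ Set.Ioc 0 (π / 2)) (hT : T ∈ M.admissible Θ)
    (h0 : ∀ f, 0 < k 0 f) (hs : ∀ m, M.CurvatureStep Θ T (k m) (k (m + 1)))
    (hle : M.faceCurvature Θ (k 0) ≤ T) :
    ∃ l : M.Face → ℝ, (∀ f, 0 < l f) ∧ Tendsto k atTop (𝓝 l) := by
  classical
  obtain ⟨hmono, hbd⟩ := curvatureSeq_monotone hΘ h0 hs hle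
  have hmf : ∀ f, Monotone fun m => k m f := fun f a b hab => hmono hab f
  have hpos := curvatureSeq_pos h0 hs
  have hB : ∀ f, BddAbove (Set.range fun m => k m f) := by
    by_contra hne
    -- On `F'` the monotone sequences eventually exceed every `X`, elsewhere they share a bound `Y`;
    -- admissibility then makes the total over `F'` too large for a subsolution.
    set F' := Finset.univ.filter fun f => ¬ BddAbove (Set.range fun m => k m f) with hF'
    have hF : F'.Nonempty := by
      simp only [not_forall] at hne
      obtain ⟨f, hf⟩ := hne
      exact ⟨f, by simpa [hF'] using hf⟩
    have hY : ∃ Y, ∀ f, f ∉ F' → ∀ m, k m f ≤ Y := by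
      have : ∀ f, ∃ y, f ∉ F' → ∀ m, k m f ≤ y := by
        intro f
        by_cases hf : f ∈ F'
        · exact ⟨0, fun h => absurd hf h⟩
        · have : BddAbove (Set.range fun m => k m f) := by simpa [hF'] using hf
          obtain ⟨y, hy⟩ := this
          exact ⟨y, fun _ m => hy ⟨m, rfl⟩⟩
      choose y hy using this
      obtain ⟨Y, hY⟩ := Finite.bddAbove_range y
      exact ⟨Y, fun f hf m => (hy f hf m).trans (hY ⟨f, rfl⟩)⟩
    obtain ⟨Y, hY⟩ := hY
    obtain ⟨X, hX⟩ := exists_sum_lt_sum_faceCurvature hΘ hT hF Y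
    have hev : ∀ f ∈ F', ∀ᶠ m in atTop, X ≤ k m f := by
      intro f hf
      exact (tendsto_atTop_atTop_of_monotone' (hmf f) (by simpa [hF'] using hf)).eventually_ge_atTop X
    obtain ⟨m, hm⟩ := ((Filter.eventually_all_finset F').2 hev).exists
    have := hX (k m) (hpos m) hm (fun f hf => hY f hf m)
    exact absurd this (not_lt.2 (Finset.sum_le_sum fun f _ => hbd m f))
  refine ⟨fun f => ⨆ m, k m f, fun f => (h0 f).trans_le (le_ciSup (hB f) 0), ?_⟩
  exact tendsto_pi_nhds.2 fun f => tendsto_atTop_ciSup (hmf f) (hB f)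

theorem curvatureSeq_tendsto_of_ge (hΘ : ∀ e, Θ e ∈ Set.Ioc 0 (π / 2)) (hT : T ∈ M.admissible Θ)
    (h0 : ∀ f, 0 < k 0 f) (hs : ∀ m, M.CurvatureStep Θ T (k m) (k (m + 1)))
    (hge : T ≤ M.faceCurvature Θ (k 0)) :
    ∃ l : M.Face → ℝ, (∀ f, 0 < l f) ∧ Tendsto k atTop (𝓝 l) := by
  obtain ⟨hanti, hbd⟩ := curvatureSeq_antitone hΘ h0 hs hge
  have hpos := curvatureSeq_pos h0 hs
  set C := π * Fintype.card Dart with hC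
  have hC0 : 0 ≤ C := by positivity
  have hlow : ∀ f m, T f / (C + 1) ≤ k m f := by
    intro f m
    rw [div_le_iff₀ (by positivity)]
    have h1 := (hbd m f).trans (faceCurvature_le_mul hΘ (hpos m) f)
    rw [← hC] at h1
    have h2 := hpos m f
    linarith
  refine ⟨fun f => ⨅ m, k m f, fun f => ?_, tendsto_pi_nhds.2 fun f =>
    tendsto_atTop_ciInf (fun a b hab => hanti hab f) ⟨_, Set.forall_mem_range.2 (hlow f)⟩⟩
  have := hT.1 f
  exact (show 0 < T f / (C + 1) by positivity).trans_le (le_ciInf (hlow f))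

end Sequence

theorem exists_faceCurvature_eq (hΘ : ∀ e, Θ e ∈ Set.Ioc 0 (π / 2)) (hT : T ∈ M.admissible Θ) :
    ∃ l : M.Face → ℝ, (∀ f, 0 < l f) ∧ M.faceCurvature Θ l = T := by
  set C := π * Fintype.card Dart with hC
  have hC0 : 0 ≤ C := by positivity
  -- The vector `T / (C + 1)` is a subsolution by the linear bound; the summand `1` makes the
  -- denominator positive without further argument.
  have hx : ∀ f, 0 < T f / (C + 1) := fun f => by have := hT.1 f; positivity
  obtain ⟨k, hk0, hs⟩ := exists_curvatureSeq hΘ hT hx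
  have h0 : ∀ f, 0 < k 0 f := by rw [hk0]; exact hx
  obtain ⟨l, hl, hlim⟩ := curvatureSeq_tendsto_of_le hΘ hT h0 hs (by
    intro f
    refine (faceCurvature_le_mul hΘ h0 f).trans ?_
    rw [hk0, ← hC]
    have := hT.1 f
    rw [div_mul_eq_mul_div, div_le_iff₀ (by positivity)]
    linarith)
  exact ⟨l, hl, faceCurvature_eq_of_tendsto hΘ hs hlim⟩

theorem curvatureSeq_tendsto (hΘ : ∀ e, Θ e ∈ Set.Ioc 0 (π / 2)) (hT : T ∈ M.admissible Θ)
    {k : ℕ → M.Face → ℝ} (h0 : ∀ f, 0 < k 0 f)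
    (hs : ∀ m, M.CurvatureStep Θ T (k m) (k (m + 1))) {l : M.Face → ℝ} (hl : ∀ f, 0 < l f)
    (hlT : M.faceCurvature Θ l = T) : Tendsto k atTop (𝓝 l) := by
  -- There are finitely many faces, so the ratios of `k 0` and `l`, both ways, have a common bound
  -- `s`.
  obtain ⟨s, hs1, hup, hlo⟩ : ∃ s : ℝ, 1 ≤ s ∧ k 0 ≤ s • l ∧ s⁻¹ • l ≤ k 0 := by
    obtain ⟨a, ha⟩ := Finite.bddAbove_range fun f => k 0 f / l f
    obtain ⟨b, hb⟩ := Finite.bddAbove_range fun f => l f / k 0 f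
    refine ⟨max 1 (max a b), le_max_left _ _, fun f => ?_, fun f => ?_⟩
    · have h1 : k 0 f / l f ≤ max 1 (max a b) :=
        (ha ⟨f, rfl⟩).trans ((le_max_left a b).trans (le_max_right _ _))
      exact (div_le_iff₀ (hl f)).1 h1
    · have h1 : l f / k 0 f ≤ max 1 (max a b) :=
        (hb ⟨f, rfl⟩).trans ((le_max_right a b).trans (le_max_right _ _))
      have h2 := (div_le_iff₀ (h0 f)).1 h1
      simp only [Pi.smul_apply, smul_eq_mul]
      exact (inv_mul_le_iff₀ (lt_max_of_lt_left one_pos)).2 h2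
  have hs0 : 0 < s := by linarith
  have hpu : ∀ f, 0 < (s • l) f := fun f => mul_pos hs0 (hl f)
  have hpl : ∀ f, 0 < (s⁻¹ • l) f := fun f => mul_pos (inv_pos.2 hs0) (hl f)
  obtain ⟨u, hu0, hus⟩ := exists_curvatureSeq hΘ hT hpu
  obtain ⟨v, hv0, hvs⟩ := exists_curvatureSeq hΘ hT hpl
  have hu0p : ∀ f, 0 < u 0 f := by rw [hu0]; exact hpu
  have hv0p : ∀ f, 0 < v 0 f := by rw [hv0]; exact hpl
  obtain ⟨u', hu'p, hu'⟩ := curvatureSeq_tendsto_of_ge hΘ hT hu0p hus (by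
    rw [hu0, ← hlT]; exact faceCurvature_le_smul hΘ hl hs1)
  obtain ⟨v', hv'p, hv'⟩ := curvatureSeq_tendsto_of_le hΘ hT hv0p hvs (by
    rw [hv0, ← hlT]
    have := faceCurvature_le_smul hΘ hpl hs1
    rwa [smul_inv_smul₀ hs0.ne'] at this)
  have eu : u' = l := faceCurvature_injective hΘ hu'p hl
    ((faceCurvature_eq_of_tendsto hΘ hus hu').trans hlT.symm)
  have ev : v' = l := faceCurvature_injective hΘ hv'p hl
    ((faceCurvature_eq_of_tendsto hΘ hvs hv').trans hlT.symm)
  subst eu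
  rw [ev] at hv'
  have hku : ∀ m, k m ≤ u m := fun m => by
    induction m with
    | zero => rw [hu0]; exact hup
    | succ m ih => exact (hs m).mono hΘ (curvatureSeq_pos h0 hs m) (hus m) ih
  have hvk : ∀ m, v m ≤ k m := fun m => by
    induction m with
    | zero => rw [hv0]; exact hlo
    | succ m ih => exact (hvs m).mono hΘ (curvatureSeq_pos hv0p hvs m) (hs m) ih
  exact tendsto_pi_nhds.2 fun f => tendsto_of_tendsto_of_tendsto_of_le_of_le
    (tendsto_pi_nhds.1 hv' f) (tendsto_pi_nhds.1 hu' f) (fun m => hvk m f) (fun m => hku m f)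

end SurfaceGraph

/-! ### Two intersecting circles on the sphere -/

theorem norm_sub_inner_smul {E : Type*} [NormedAddCommGroup E] [InnerProductSpace ℝ E] {p a : E}
    (hp : ‖p‖ = 1) (ha : ‖a‖ = 1) :
    ‖a - (inner ℝ a p : ℝ) • p‖ = √(1 - (inner ℝ a p : ℝ) ^ 2) := by
  have h : ‖a - (inner ℝ a p : ℝ) • p‖ ^ 2 = 1 - (inner ℝ a p : ℝ) ^ 2 := by
    rw [norm_sub_sq_real, inner_smul_right, norm_smul, hp, ha, mul_one, Real.norm_eq_abs, sq_abs]
    ring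
  rw [← h, Real.sqrt_sq (norm_nonneg _)]

theorem sphericalAngle_eq {p a b : Space3} (hp : ‖p‖ = 1) (ha : ‖a‖ = 1) (hb : ‖b‖ = 1) :
    sphericalAngle p a b = arccos (((inner ℝ a b : ℝ) - (inner ℝ a p : ℝ) * (inner ℝ b p : ℝ)) /
      (√(1 - (inner ℝ a p : ℝ) ^ 2) * √(1 - (inner ℝ b p : ℝ) ^ 2))) := by
  unfold sphericalAngle InnerProductGeometry.angle
  rw [norm_sub_inner_smul hp ha, norm_sub_inner_smul hp hb]
  congr 2
  simp only [inner_sub_left, inner_sub_right, inner_smul_left, inner_smul_right,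
    real_inner_self_eq_norm_sq, hp, RCLike.conj_to_real]
  rw [real_inner_comm b p]
  ring

theorem inner_spherePoint (ρ t ρ' t' : ℝ) : (inner ℝ (spherePoint ρ t) (spherePoint ρ' t') : ℝ) =
    sin ρ * sin ρ' * (cos t * cos t' + sin t * sin t') + cos ρ * cos ρ' := by
  simp [spherePoint, PiLp.inner_apply, Fin.sum_univ_three]
  ring

theorem norm_spherePoint (ρ t : ℝ) : ‖spherePoint ρ t‖ = 1 := by
  have h : ‖spherePoint ρ t‖ ^ 2 = 1 := by
    rw [← real_inner_self_eq_norm_sq, inner_spherePoint]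
    linear_combination sin ρ ^ 2 * sin_sq_add_cos_sq t + sin_sq_add_cos_sq ρ
  nlinarith [norm_nonneg (spherePoint ρ t)]

theorem northPole_eq : northPole = spherePoint 0 0 := by
  simp [northPole, spherePoint]

theorem bigonAngle_eq {r A ℓ s : ℝ} (hr : 0 < sin r) (hs : 0 < sin s)
    (h : sin ℓ * sin r * cos A + cos ℓ * cos r = cos s) :
    bigonAngle (spherePoint r A) northPole (spherePoint ℓ 0) =
      π - arccos ((cos ℓ - cos r * cos s) / (sin r * sin s)) := by
  have e1 : (inner ℝ (spherePoint 0 0) (spherePoint r A) : ℝ) = cos r := by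
    rw [inner_spherePoint]; simp
  have e2 : (inner ℝ (spherePoint ℓ 0) (spherePoint r A) : ℝ) = cos s := by
    rw [inner_spherePoint, ← h]; simp
  have e3 : (inner ℝ (spherePoint 0 0) (spherePoint ℓ 0) : ℝ) = cos ℓ := by
    rw [inner_spherePoint]; simp
  rw [bigonAngle, northPole_eq, sphericalAngle_eq (norm_spherePoint _ _) (norm_spherePoint _ _)
    (norm_spherePoint _ _), e1, e2, e3, ← sin_sq, ← sin_sq, Real.sqrt_sq hr.le, Real.sqrt_sq hs.le]

theorem spherePoint_eq_halfTurn_iff {r A ℓ s B : ℝ} :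
    spherePoint r A = halfTurn ℓ (spherePoint s (-B)) ↔
      sin r * cos A = -cos ℓ * (sin s * cos B) + sin ℓ * cos s ∧ sin r * sin A = sin s * sin B ∧
        cos r = sin ℓ * (sin s * cos B) + cos ℓ * cos s := by
  constructor
  · intro h
    have h0 := congrArg (fun v : Space3 => v 0) h
    have h1 := congrArg (fun v : Space3 => v 1) h
    have h2 := congrArg (fun v : Space3 => v 2) h
    simpa [spherePoint, halfTurn] using And.intro h0 (And.intro h1 h2)
  · rintro ⟨h0, h1, h2⟩
    ext i
    fin_cases i <;> simp [spherePoint, halfTurn, h0, h1, h2]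

theorem cot_pos_of_mem_Ioo {r : ℝ} (hr : r ∈ Set.Ioo 0 (π / 2)) : 0 < cot r := by
  rw [cot_eq_cos_div_sin]
  exact div_pos (cos_pos_of_mem_Ioo ⟨by linarith [hr.1, pi_pos], hr.2⟩)
    (sin_pos_of_pos_of_lt_pi hr.1 (by linarith [hr.2, pi_pos]))

theorem sqrt_one_add_cot_sq {r : ℝ} (hr : 0 < sin r) : √(1 + cot r ^ 2) = 1 / sin r := by
  have : 1 + cot r ^ 2 = (1 / sin r) ^ 2 := by
    rw [cot_eq_cos_div_sin]; field_simp; linarith [sin_sq_add_cos_sq r]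
  rw [this, Real.sqrt_sq (by positivity)]

/-- The cotangent of the half-angle, in terms of the radii. -/
theorem halfAngle_arg_eq {r s θ : ℝ} (hr : 0 < sin r) (hs : 0 < sin s) :
    (cot s + cot r * cos θ) / (sin θ * √(1 + cot r ^ 2)) =
      (sin r * cos s + cos r * sin s * cos θ) / (sin s * sin θ) := by
  rw [sqrt_one_add_cot_sq hr, cot_eq_cos_div_sin, cot_eq_cos_div_sin]
  field_simp

theorem sin_sq_eq_of_cos_eq {r s ℓ θ : ℝ} (h : cos ℓ = cos r * cos s - sin r * sin s * cos θ) :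
    sin ℓ ^ 2 = (sin s * sin θ) ^ 2 + (sin r * cos s + cos r * sin s * cos θ) ^ 2 := by
  rw [sin_sq, h]
  have h1 := sin_sq_add_cos_sq r
  have h2 := sin_sq_add_cos_sq s
  have h3 := sin_sq_add_cos_sq θ
  have h1' : sin r ^ 2 = 1 - cos r ^ 2 := by linarith
  have h2' : sin s ^ 2 = 1 - cos s ^ 2 := by linarith
  have h3' : sin θ ^ 2 = 1 - cos θ ^ 2 := by linarith
  ring_nf
  rw [h1', h2', h3']
  ring

/-- The corner and the angle of a bigon determine the distance of the centers and the central
angle. -/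
theorem eq_halfAngle_of_corner {r s A B ℓ θ : ℝ} (hr : r ∈ Set.Ioo 0 (π / 2))
    (hs : s ∈ Set.Ioo 0 (π / 2)) (hA : A ∈ Set.Ioo 0 π) (hℓ : ℓ ∈ Set.Ioo 0 π)
    (hθ : θ ∈ Set.Ioc 0 (π / 2))
    (hc : spherePoint r A = halfTurn ℓ (spherePoint s (-B)))
    (ha : bigonAngle (spherePoint r A) northPole (spherePoint ℓ 0) = θ) :
    A = halfAngle θ (cot r) (cot s) ∧ ℓ = arccos (cos r * cos s - sin r * sin s * cos θ) := by
  have hr0 : 0 < sin r := sin_pos_of_pos_of_lt_pi hr.1 (by linarith [hr.2, pi_pos])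
  have hs0 : 0 < sin s := sin_pos_of_pos_of_lt_pi hs.1 (by linarith [hs.2, pi_pos])
  have hℓ0 : 0 < sin ℓ := sin_pos_of_pos_of_lt_pi hℓ.1 hℓ.2
  have hA0 : 0 < sin A := sin_pos_of_pos_of_lt_pi hA.1 hA.2
  have hθ0 : 0 < sin θ := sin_pos_of_mem_Ioc hθ
  obtain ⟨h0, h1, h2⟩ := spherePoint_eq_halfTurn_iff.1 hc
  -- This expresses that the corner lies at distance `s` from the second center.
  have h3 : sin ℓ * sin r * cos A + cos ℓ * cos r = cos s := by
    linear_combination sin ℓ * h0 + cos ℓ * h2 + cos s * sin_sq_add_cos_sq ℓ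
  have hcos : cos ℓ = cos r * cos s - sin r * sin s * cos θ := by
    have hang : cos (sphericalAngle (spherePoint r A) northPole (spherePoint ℓ 0)) = -cos θ := by
      rw [← ha, bigonAngle, cos_pi_sub, neg_neg]
    unfold sphericalAngle at hang
    have e1 : (inner ℝ northPole (spherePoint r A) : ℝ) = cos r := by
      rw [northPole_eq, inner_spherePoint]; simp
    have e2 : (inner ℝ (spherePoint ℓ 0) (spherePoint r A) : ℝ) = cos s := by
      rw [inner_spherePoint, ← h3]; simp
    have e3 : (inner ℝ northPole (spherePoint ℓ 0) : ℝ) = cos ℓ := by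
      rw [northPole_eq, inner_spherePoint]; simp
    have hn : ‖northPole‖ = 1 := by rw [northPole_eq, norm_spherePoint]
    rw [InnerProductGeometry.cos_angle, norm_sub_inner_smul (norm_spherePoint _ _) hn,
      norm_sub_inner_smul (norm_spherePoint _ _) (norm_spherePoint _ _)] at hang
    simp only [inner_sub_left, inner_sub_right, inner_smul_left, inner_smul_right,
      real_inner_self_eq_norm_sq, norm_spherePoint, RCLike.conj_to_real] at hang
    rw [real_inner_comm (spherePoint ℓ 0) (spherePoint r A), e1, e2, e3, ← sin_sq, ← sin_sq,
      Real.sqrt_sq hr0.le, Real.sqrt_sq hs0.le, div_eq_iff (by positivity)] at hang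
    linarith
  refine ⟨?_, ?_⟩
  -- `h4` and the law of sines `h5` give `cot A`; since `0 < A < π`, this determines `A`. In `h5`
  -- only the squares are compared, as both sides are nonnegative.
  · have h4 : sin ℓ * cos A = sin r * cos s + cos r * sin s * cos θ := by
      have : sin r * (sin ℓ * cos A) = sin r * (sin r * cos s + cos r * sin s * cos θ) := by
        rw [hcos] at h3
        linear_combination h3 - cos s * sin_sq_add_cos_sq r
      exact mul_left_cancel₀ hr0.ne' this
    have h5 : sin ℓ * sin A = sin s * sin θ := by
      have : (sin ℓ * sin A) ^ 2 = (sin s * sin θ) ^ 2 := by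
        have := sin_sq_eq_of_cos_eq hcos
        rw [← h4] at this
        linear_combination this + sin ℓ ^ 2 * sin_sq_add_cos_sq A
      exact (pow_left_inj₀ (by positivity) (by positivity) two_ne_zero).1 this
    rw [halfAngle, halfAngle_arg_eq hr0 hs0, ← h4, ← h5, mul_div_mul_left _ _ hℓ0.ne',
      ← inv_div (sin A), ← tan_eq_sin_div_cos, ← tan_pi_div_two_sub,
      arctan_tan (by linarith [hA.2]) (by linarith [hA.1])]
    ring
  · rw [← hcos, arccos_cos hℓ.1.le hℓ.2.le]

theorem sin_mul_halfAngle {r s ℓ θ : ℝ} (hr : 0 < sin r) (hs : 0 < sin s) (hθ : 0 < sin θ)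
    (hℓ : 0 < sin ℓ) (h : cos ℓ = cos r * cos s - sin r * sin s * cos θ) :
    sin ℓ * sin (halfAngle θ (cot r) (cot s)) = sin s * sin θ ∧
      sin ℓ * cos (halfAngle θ (cot r) (cot s)) = sin r * cos s + cos r * sin s * cos θ := by
  rw [halfAngle, sin_pi_div_two_sub, cos_pi_div_two_sub, cos_arctan, sin_arctan,
    halfAngle_arg_eq hr hs]
  have hm : 0 < sin s * sin θ := mul_pos hs hθ
  have h1 := sin_sq_eq_of_cos_eq h
  generalize sin r * cos s + cos r * sin s * cos θ = n at *
  generalize sin s * sin θ = q at *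
  have : √(1 + (n / q) ^ 2) = sin ℓ / q := by
    rw [show 1 + (n / q) ^ 2 = (sin ℓ / q) ^ 2 by rw [div_pow, div_pow, h1]; field_simp,
      Real.sqrt_sq (by positivity)]
  rw [this]
  constructor <;> field_simp

theorem corner_of_halfAngle {r s θ ℓ : ℝ} (hr : 0 < sin r) (hs : 0 < sin s) (hθ : 0 < sin θ)
    (hℓ : 0 < sin ℓ) (h : cos ℓ = cos r * cos s - sin r * sin s * cos θ) :
    spherePoint r (halfAngle θ (cot r) (cot s)) =
      halfTurn ℓ (spherePoint s (-halfAngle θ (cot s) (cot r))) := by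
  obtain ⟨a1, a2⟩ := sin_mul_halfAngle hr hs hθ hℓ h
  have h' : cos ℓ = cos s * cos r - sin s * sin r * cos θ := by rw [h]; ring
  obtain ⟨b1, b2⟩ := sin_mul_halfAngle hs hr hθ hℓ h'
  have hq := sin_sq_add_cos_sq ℓ
  have hq1 := sin_sq_add_cos_sq r
  have hq2 := sin_sq_add_cos_sq s
  rw [spherePoint_eq_halfTurn_iff]
  refine ⟨mul_left_cancel₀ hℓ.ne' ?_, mul_left_cancel₀ hℓ.ne' ?_, mul_left_cancel₀ hℓ.ne' ?_⟩
  · linear_combination sin r * a2 + cos ℓ * sin s * b2 - cos s * hq + cos ℓ * cos s * h +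
      cos ℓ * cos r * hq2 + cos s * hq1 + cos r * h
  · linear_combination sin r * a1 - sin s * b1
  · linear_combination -sin ℓ * sin s * b2 - sin ℓ * cos s * h - sin ℓ * cos r * hq2

theorem bigonAngle_of_halfAngle {r s θ ℓ : ℝ} (hr : 0 < sin r) (hs : 0 < sin s)
    (hθ : θ ∈ Set.Ioc 0 (π / 2))
    (hℓ : 0 < sin ℓ) (h : cos ℓ = cos r * cos s - sin r * sin s * cos θ) :
    bigonAngle (spherePoint r (halfAngle θ (cot r) (cot s))) northPole (spherePoint ℓ 0) = θ := by
  obtain ⟨a1, a2⟩ := sin_mul_halfAngle hr hs (sin_pos_of_mem_Ioc hθ) hℓ h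
  rw [bigonAngle_eq hr hs]
  · have : (cos ℓ - cos r * cos s) / (sin r * sin s) = -cos θ := by
      rw [h]; field_simp; ring
    rw [this, arccos_neg, arccos_cos hθ.1.le (by linarith [hθ.2, pi_pos])]
    ring
  · linear_combination sin r * a2 + cos r * h + cos s * sin_sq_add_cos_sq r

theorem arccos_centerDist_mem {r s θ : ℝ} (hr : r ∈ Set.Ioo 0 (π / 2))
    (hs : s ∈ Set.Ioo 0 (π / 2)) (hθ : θ ∈ Set.Ioc 0 (π / 2)) :
    arccos (cos r * cos s - sin r * sin s * cos θ) ∈ Set.Ioo 0 π ∧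
      cos (arccos (cos r * cos s - sin r * sin s * cos θ)) =
        cos r * cos s - sin r * sin s * cos θ := by
  have hr0 : 0 < sin r := sin_pos_of_pos_of_lt_pi hr.1 (by linarith [hr.2, pi_pos])
  have hs0 : 0 < sin s := sin_pos_of_pos_of_lt_pi hs.1 (by linarith [hs.2, pi_pos])
  have hr1 : 0 < cos r := cos_pos_of_mem_Ioo ⟨by linarith [hr.1, pi_pos], hr.2⟩
  have hs1 : 0 < cos s := cos_pos_of_mem_Ioo ⟨by linarith [hs.1, pi_pos], hs.2⟩
  have hθ0 := sin_pos_of_mem_Ioc hθ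
  have hlt : (cos r * cos s - sin r * sin s * cos θ) ^ 2 < 1 := by
    have : 1 - (cos r * cos s - sin r * sin s * cos θ) ^ 2 =
        (sin s * sin θ) ^ 2 + (sin r * cos s + cos r * sin s * cos θ) ^ 2 := by
      have h1' : sin r ^ 2 = 1 - cos r ^ 2 := by linarith [sin_sq_add_cos_sq r]
      have h2' : sin s ^ 2 = 1 - cos s ^ 2 := by linarith [sin_sq_add_cos_sq s]
      have h3' : sin θ ^ 2 = 1 - cos θ ^ 2 := by linarith [sin_sq_add_cos_sq θ]
      ring_nf
      rw [h1', h2', h3']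
      ring
    have : 0 < (sin s * sin θ) ^ 2 := by positivity
    nlinarith [sq_nonneg (sin r * cos s + cos r * sin s * cos θ)]
  obtain ⟨h1, h2⟩ := abs_lt.1 ((sq_lt_one_iff_abs_lt_one _).1 hlt)
  exact ⟨⟨arccos_pos.2 h2, arccos_lt_pi.2 h1⟩, cos_arccos h1.le h2.le⟩

/-! ### The gluing of disks with disjoint sectors -/

theorem halfTurn_halfTurn (ℓ : ℝ) (v : Space3) : halfTurn ℓ (halfTurn ℓ v) = v := by
  have h := sin_sq_add_cos_sq ℓ
  ext i
  fin_cases i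
  · simp [halfTurn]; linear_combination v 0 * h
  · simp [halfTurn]
  · simp [halfTurn]; linear_combination v 2 * h

theorem spherePoint_injective {ρ ρ' t t' : ℝ} (hρ : ρ ∈ Set.Ioo 0 π) (hρ' : ρ' ∈ Set.Ioo 0 π)
    (ht : |t| < π) (ht' : |t'| < π) (h : spherePoint ρ t = spherePoint ρ' t') :
    ρ = ρ' ∧ t = t' := by
  have h0 := congrArg (fun v : Space3 => v 0) h
  have h1 := congrArg (fun v : Space3 => v 1) h
  have h2 := congrArg (fun v : Space3 => v 2) h
  simp only [spherePoint, PiLp.toLp_apply, Matrix.cons_val] at h0 h1 h2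
  have e : ρ = ρ' := injOn_cos ⟨hρ.1.le, hρ.2.le⟩ ⟨hρ'.1.le, hρ'.2.le⟩ h2
  subst e
  have hs := (sin_pos_of_pos_of_lt_pi hρ.1 hρ.2).ne'
  have hc := mul_left_cancel₀ hs h0
  have hsn := mul_left_cancel₀ hs h1
  rw [abs_lt] at ht ht'
  have : cos (t - t') = 1 := by
    rw [cos_sub, hc, hsn]; linarith [sin_sq_add_cos_sq t']
  have := (cos_eq_one_iff_of_lt_of_lt (by linarith [ht.1, ht'.2]) (by linarith [ht.2, ht'.1])).1 this
  exact ⟨rfl, by linarith⟩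

namespace PatternData

variable {Dart : Type*} {M : SurfaceGraph Dart} {P : PatternData M}

/-- The sectors are laid out one after another in the interval `[0, coneAngle]`. -/
structure SectorsDisjoint (P : PatternData M) : Prop where
  radius_lt : ∀ f, P.radius f < π
  centralAngle_lt : ∀ d, P.centralAngle d < 2 * π
  start_nonneg : ∀ d, 0 ≤ P.start d
  end_le : ∀ d, P.start d + P.centralAngle d ≤ P.coneAngle (M.face d)
  disjoint : ∀ d d', M.face d = M.face d' → d ≠ d' →
    P.start d + P.centralAngle d ≤ P.start d' ∨ P.start d' + P.centralAngle d' ≤ P.start d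

theorem polar_eq_polar {f f' : M.Face} {ρ : Set.Ioo 0 (P.radius f)} {ρ' : Set.Ioo 0 (P.radius f')}
    {a a' : ℝ} (h : (⟨f, .polar ρ (a : AddCircle (P.coneAngle f))⟩ : Σ f, P.Disk f) =
      ⟨f', .polar ρ' (a' : AddCircle (P.coneAngle f'))⟩) :
    f = f' ∧ (ρ : ℝ) = ρ' ∧ ∃ n : ℤ, n * P.coneAngle f = a - a' := by
  obtain ⟨rfl, h⟩ := Sigma.mk.inj h
  have h := eq_of_heq h
  injection h with h1 h2
  refine ⟨rfl, congrArg Subtype.val h1, ?_⟩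
  obtain ⟨n, hn⟩ := (AddCircle.coe_eq_zero_iff _).1
    (show ((a - a' : ℝ) : AddCircle (P.coneAngle f)) = 0 by rw [AddCircle.coe_sub, h2, sub_self])
  exact ⟨n, by simpa using hn⟩

/-- Both angular coordinates have representatives strictly inside `[0, coneAngle]`. Hence these
differ by less than a period and agree as real numbers, and the sectors do not overlap. -/
theorem SectorsDisjoint.sector_unique (hP : P.SectorsDisjoint) {d d' : Dart}
    {x : P.Disk (M.face d)} {x' : P.Disk (M.face d')} {ρ t ρ' t' : ℝ}
    (h : P.SectorPoint d x ρ t) (h' : P.SectorPoint d' x' ρ' t')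
    (he : (⟨M.face d, x⟩ : Σ f, P.Disk f) = ⟨M.face d', x'⟩) : d = d' ∧ ρ = ρ' ∧ t = t' := by
  obtain ⟨ht, hρ, rfl⟩ := h
  obtain ⟨ht', hρ', rfl⟩ := h'
  obtain ⟨hf, e1, n, hn⟩ := polar_eq_polar he
  rw [abs_lt] at ht ht'
  have s1 := hP.start_nonneg d
  have s2 := hP.start_nonneg d'
  have s3 := hP.end_le d
  have s4 := hP.end_le d'
  rw [← hf] at s4
  have hn0 : n = 0 := by
    have hα : 0 < P.coneAngle (M.face d) := by linarith
    have u1 : (n : ℝ) < 1 := by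
      by_contra! hge; nlinarith
    have u2 : (-1 : ℝ) < n := by
      by_contra! hge; nlinarith
    have u1' : n < 1 := by exact_mod_cast u1
    have u2' : -1 < n := by exact_mod_cast u2
    omega
  rw [hn0, Int.cast_zero, zero_mul] at hn
  have hd : d = d' := by
    by_contra hne
    rcases hP.disjoint d d' hf hne with h | h <;> linarith
  subst hd
  exact ⟨rfl, e1, by linarith⟩

theorem glue_of_sectorPoint {d e : Dart} (he : M.opp d = e) {x : P.Disk (M.face d)}
    {y : P.Disk (M.face e)} {ρ t ρ' t' : ℝ} (hx : P.SectorPoint d x ρ t)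
    (hy : P.SectorPoint e y ρ' t')
    (h : spherePoint ρ t = halfTurn (P.centerDist (M.edge d)) (spherePoint ρ' t')) :
    P.Glue ⟨M.face d, x⟩ ⟨M.face e, y⟩ := by
  subst he
  exact .mk d x y ⟨ρ, t, ρ', t', hx, hy, h⟩

theorem Glue.symm {z w : Σ f, P.Disk f} (h : P.Glue z w) : P.Glue w z := by
  obtain ⟨d, x, y, ρ, t, ρ', t', hx, hy, h⟩ := h
  refine glue_of_sectorPoint (M.opp_opp d) hy hx ?_
  rw [M.edge_opp, h, halfTurn_halfTurn]

theorem Glue.exists_eq {z w : Σ f, P.Disk f} (h : P.Glue z w) :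
    ∃ d x y, z = ⟨M.face d, x⟩ ∧ w = ⟨M.face (M.opp d), y⟩ ∧ P.Glued d x y := by
  obtain ⟨d, x, y, h⟩ := h
  exact ⟨d, x, y, rfl, rfl, h⟩

theorem SectorPoint.abs_lt_pi (hP : P.SectorsDisjoint) {d : Dart} {x : P.Disk (M.face d)}
    {ρ t : ℝ} (h : P.SectorPoint d x ρ t) : ρ ∈ Set.Ioo 0 π ∧ |t| < π := by
  obtain ⟨ht, hρ, -⟩ := h
  exact ⟨⟨hρ.1, hρ.2.trans (hP.radius_lt _)⟩, by linarith [hP.centralAngle_lt d]⟩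

/-- A point determines its sector, hence its place on the sphere, hence its partner. A symmetric
relation with at most one partner has classes of at most two points, which yields the two-to-one
condition. -/
theorem Glue.unique (hP : P.SectorsDisjoint) {z w w' : Σ f, P.Disk f} (h : P.Glue z w)
    (h' : P.Glue z w') : w = w' := by
  obtain ⟨d, x, y, rfl, rfl, ρ, t, ρ₁, t₁, hx, hy, hg⟩ := h.exists_eq
  obtain ⟨d', x', y', hz, rfl, ρ', t', ρ₁', t₁', hx', hy', hg'⟩ := h'.exists_eq
  obtain ⟨rfl, rfl, rfl⟩ := hP.sector_unique hx hx' hz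
  have hs : spherePoint ρ₁ t₁ = spherePoint ρ₁' t₁' := by
    rw [← halfTurn_halfTurn (P.centerDist (M.edge d)) (spherePoint ρ₁ t₁), ← hg, hg',
      halfTurn_halfTurn]
  obtain ⟨a, b⟩ := hy.abs_lt_pi hP
  obtain ⟨a', b'⟩ := hy'.abs_lt_pi hP
  obtain ⟨rfl, rfl⟩ := spherePoint_injective a a' b b' hs
  obtain ⟨-, _, rfl⟩ := hy
  obtain ⟨-, _, rfl⟩ := hy'
  rfl

theorem SectorsDisjoint.toSurface_eq_iff (hP : P.SectorsDisjoint) {z w : Σ f, P.Disk f} :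
    P.toSurface z = P.toSurface w ↔ z = w ∨ P.Glue z w := by
  constructor
  · intro h
    have hg := Quot.eqvGen_exact h
    clear h
    induction hg with
    | rel _ _ h => exact Or.inr h
    | refl => exact Or.inl rfl
    | symm x y h ih =>
      rcases ih with h | h
      · exact Or.inl h.symm
      · exact Or.inr h.symm
    | trans x y z h1 h2 ih1 ih2 =>
      rcases ih1 with rfl | h1
      · exact ih2
      · rcases ih2 with rfl | h2
        · exact Or.inr h1
        · exact Or.inl (h1.symm.unique hP h2)
  · rintro (rfl | h)
    · rfl
    · exact Quot.sound h

theorem SectorsDisjoint.encard_fiber_le (hP : P.SectorsDisjoint) (p : P.PuncturedSurface) :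
    (P.toSurface ⁻¹' {p}).encard ≤ 2 := by
  obtain ⟨z, rfl⟩ := Quot.exists_rep p
  have key : ∃ w, P.toSurface ⁻¹' {Quot.mk P.Glue z} ⊆ {z, w} := by
    by_cases h : ∃ w, P.Glue z w
    · obtain ⟨w, hw⟩ := h
      refine ⟨w, fun v hv => ?_⟩
      rcases hP.toSurface_eq_iff.1 (Eq.symm hv : P.toSurface z = P.toSurface v) with rfl | h
      · exact Or.inl rfl
      · exact Or.inr (h.unique hP hw)
    · refine ⟨z, fun v hv => ?_⟩
      rcases hP.toSurface_eq_iff.1 (Eq.symm hv : P.toSurface z = P.toSurface v) with rfl | h'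
      · exact Or.inl rfl
      · exact absurd ⟨v, h'⟩ h
  obtain ⟨w, hw⟩ := key
  exact (Set.encard_le_encard hw).trans (by
    refine (Set.encard_insert_le _ _).trans ?_
    rw [Set.encard_singleton, one_add_one_eq_two])

theorem not_glue_center {f : M.Face} {w : Σ f, P.Disk f} : ¬ P.Glue ⟨f, .center⟩ w := by
  intro h
  obtain ⟨d, x, y, hz, -, ρ, t, ρ', t', ⟨-, hρ, rfl⟩, -⟩ := h.exists_eq
  obtain ⟨rfl, h⟩ := Sigma.mk.inj hz
  exact ConicalDisk.noConfusion rfl rfl h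

/-- The center of a disk lies in no sector, so it is identified with no other point. -/
theorem SectorsDisjoint.not_subset (hP : P.SectorsDisjoint) {f g : M.Face} (hfg : f ≠ g) :
    ¬ (Set.range fun x => P.toSurface ⟨f, x⟩) ⊆ Set.range fun x => P.toSurface ⟨g, x⟩ := by
  intro h
  obtain ⟨x, hx⟩ := h ⟨.center, rfl⟩
  rcases hP.toSurface_eq_iff.1 (Eq.symm hx) with h | h
  · exact hfg (congrArg Sigma.fst h)
  · exact not_glue_center h

end PatternData

/-! ### Placing the sectors around a face -/

namespace SurfaceGraph

variable {Dart : Type*} (M : SurfaceGraph Dart)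

theorem face_next (d : Dart) : M.face (M.next d) = M.face d :=
  Quotient.sound (Equiv.Perm.sameCycle_apply_left.2 (Equiv.Perm.SameCycle.refl _ _))

theorem face_iterate_next (i : ℕ) (d : Dart) : M.face (M.next^[i] d) = M.face d := by
  induction i with
  | zero => rfl
  | succ i ih => rw [Function.iterate_succ_apply', face_next, ih]

/-- A chosen dart of a face. -/
def baseDart (f : M.Face) : Dart := Quotient.out f

theorem face_baseDart (f : M.Face) : M.face (M.baseDart f) = f := Quotient.out_eq f

/-- The number of sides of a face. -/
def faceDegree (f : M.Face) : ℕ := Function.minimalPeriod M.next (M.baseDart f)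

variable [Finite Dart]

theorem exists_iterate_next_eq {d d' : Dart} (h : M.face d = M.face d') :
    ∃ i, M.next^[i] d = d' := by
  obtain ⟨i, hi⟩ := Equiv.Perm.SameCycle.exists_nat_pow_eq (Quotient.exact h)
  exact ⟨i, by rw [Equiv.Perm.iterate_eq_pow, hi]⟩

theorem exists_index (d : Dart) :
    ∃ i < M.faceDegree (M.face d), M.next^[i] (M.baseDart (M.face d)) = d := by
  obtain ⟨i, hi⟩ := M.exists_iterate_next_eq (M.face_baseDart (M.face d))
  have hpos : 0 < M.faceDegree (M.face d) :=
    Function.minimalPeriod_pos_of_mem_periodicPts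
      (M.next.injective.mem_periodicPts (M.baseDart (M.face d)))
  refine ⟨i % M.faceDegree (M.face d), Nat.mod_lt _ hpos, ?_⟩
  rw [faceDegree, Function.iterate_mod_minimalPeriod_eq, hi]

/-- The position of a dart among the sides of its face. -/
def index (d : Dart) : ℕ := (M.exists_index d).choose

theorem index_lt (d : Dart) : M.index d < M.faceDegree (M.face d) :=
  (M.exists_index d).choose_spec.1

theorem iterate_index (d : Dart) : M.next^[M.index d] (M.baseDart (M.face d)) = d :=
  (M.exists_index d).choose_spec.2

theorem index_eq {d : Dart} {i : ℕ} (hi : i < M.faceDegree (M.face d))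
    (h : M.next^[i] (M.baseDart (M.face d)) = d) : M.index d = i :=
  Function.iterate_injOn_Iio_minimalPeriod (M.index_lt d) hi ((M.iterate_index d).trans h.symm)

/-- The sum of `c` over the darts of `f` from the base dart on, up to the `i`-th. -/
def partialAngle {Dart : Type*} (M : SurfaceGraph Dart) (c : Dart → ℝ) (f : M.Face) (i : ℕ) : ℝ :=
  ∑ j ∈ Finset.range i, c (M.next^[j] (M.baseDart f))

theorem partialAngle_mono {Dart : Type*} (M : SurfaceGraph Dart) {c : Dart → ℝ} (hc : ∀ d, 0 < c d) (f : M.Face) :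
    Monotone (M.partialAngle c f) :=
  monotone_nat_of_le_succ fun i => by
    rw [partialAngle, partialAngle, Finset.sum_range_succ]
    linarith [hc (M.next^[i] (M.baseDart f))]

theorem partialAngle_index_add (c : Dart → ℝ) (d : Dart) :
    M.partialAngle c (M.face d) (M.index d) + c d =
      M.partialAngle c (M.face d) (M.index d + 1) := by
  rw [partialAngle, partialAngle, Finset.sum_range_succ, M.iterate_index]

theorem partialAngle_faceDegree (c : Dart → ℝ) (f : M.Face) :
    M.partialAngle c f (M.faceDegree f) = ∑ᶠ d ∈ {d | M.face d = f}, c d := by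
  rw [partialAngle, ← finsum_mem_coe_finset]
  refine finsum_mem_eq_of_bijOn (fun j => M.next^[j] (M.baseDart f)) ⟨?_, ?_, ?_⟩ fun _ _ => rfl
  · intro i _
    simp only [Set.mem_ofPred_eq, face_iterate_next, face_baseDart]
  · rw [Finset.coe_range]
    exact Function.iterate_injOn_Iio_minimalPeriod
  · rintro d rfl
    exact ⟨M.index d, by simpa using M.index_lt d, M.iterate_index d⟩

theorem partialAngle_index_next (c : Dart → ℝ) (d : Dart) :
    ((M.partialAngle c (M.face (M.next d)) (M.index (M.next d)) : ℝ) :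
        AddCircle (∑ᶠ d' ∈ {d' | M.face d' = M.face d}, c d')) =
      ((M.partialAngle c (M.face d) (M.index d) + c d : ℝ) : AddCircle _) := by
  rw [partialAngle_index_add, ← partialAngle_faceDegree]
  have hb : M.next^[M.index d + 1] (M.baseDart (M.face (M.next d))) = M.next d := by
    rw [Function.iterate_succ_apply', face_next, iterate_index]
  -- After the last side the index returns to `0`, and the accumulated angle is the whole period,
  -- which is zero on the circle.
  rcases (Nat.succ_le_iff.2 (M.index_lt d)).lt_or_eq with h | h
  · rw [M.index_eq (by rw [face_next]; exact h) hb, face_next]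
  · have h0 : M.index (M.next d) = 0 := by
      refine M.index_eq (by rw [face_next]; exact Nat.zero_lt_of_lt (M.index_lt d)) ?_
      refine Eq.trans ?_ hb
      rw [← Nat.succ_eq_add_one, h, face_next, faceDegree, Function.iterate_minimalPeriod]
      rfl
    have hz : M.partialAngle c (M.face (M.next d)) 0 = 0 := Finset.sum_range_zero _
    rw [h0, ← Nat.succ_eq_add_one, h, AddCircle.coe_period, hz, AddCircle.coe_zero]

end SurfaceGraph

/-! ### Patterns with given geodesic curvatures -/

section OfCurvature

variable {Dart : Type*} (M : SurfaceGraph Dart) (Θ : M.Edge → ℝ) (k : M.Face → ℝ)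

/-- The radius of a circle of geodesic curvature `x`. -/
def radiusOf (x : ℝ) : ℝ := π / 2 - arctan x

theorem radiusOf_mem {x : ℝ} (hx : 0 < x) : radiusOf x ∈ Set.Ioo 0 (π / 2) :=
  ⟨sub_pos.2 (arctan_lt_pi_div_two x), by have := arctan_pos.2 hx; unfold radiusOf; linarith⟩

theorem cot_radiusOf (x : ℝ) : cot (radiusOf x) = x := by
  rw [← tan_inv_eq_cot, radiusOf, tan_pi_div_two_sub, tan_arctan, inv_inv]

theorem radiusOf_cot {r : ℝ} (hr : r ∈ Set.Ioo 0 (π / 2)) : radiusOf (cot r) = r := by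
  rw [radiusOf, ← tan_inv_eq_cot, ← tan_pi_div_two_sub,
    arctan_tan (by linarith [hr.2, pi_pos]) (by linarith [hr.1])]
  ring

/-- Distance of the centers of two circles of geodesic curvatures `x` and `y` that bound a bigon
of angle `θ`. -/
def centerDistOf (θ x y : ℝ) : ℝ :=
  arccos (cos (radiusOf x) * cos (radiusOf y) - sin (radiusOf x) * sin (radiusOf y) * cos θ)

theorem centerDistOf_comm (θ x y : ℝ) : centerDistOf θ x y = centerDistOf θ y x := by
  unfold centerDistOf; congr 1; ring

theorem continuous_centerDistOf (θ : ℝ) :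
    Continuous fun p : ℝ × ℝ => centerDistOf θ p.1 p.2 := by
  unfold centerDistOf radiusOf
  exact continuous_arccos.comp (by fun_prop)

/-- The central angle of the arc of a dart, for given geodesic curvatures. -/
def centralAngleOf (d : Dart) : ℝ :=
  2 * halfAngle (Θ (M.edge d)) (k (M.face d)) (k (M.face (M.opp d)))

variable [Finite Dart]

/-- The data of the circle pattern with given geodesic curvatures. -/
def PatternData.ofCurvature : PatternData M where
  radius f := radiusOf (k f)
  coneAngle f := ∑ᶠ d ∈ {d | M.face d = f}, centralAngleOf M Θ k d
  start d := M.partialAngle (centralAngleOf M Θ k) (M.face d) (M.index d)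
  centralAngle := centralAngleOf M Θ k
  centerDist e := centerDistOf (Θ e) (k (M.face (Quotient.out e)))
    (k (M.face (M.opp (Quotient.out e))))

/-- The representative chosen for an edge does not matter, because the distance is symmetric in the
two circles. -/
theorem PatternData.ofCurvature_centerDist (d : Dart) :
    (ofCurvature M Θ k).centerDist (M.edge d) =
      centerDistOf (Θ (M.edge d)) (k (M.face d)) (k (M.face (M.opp d))) := by
  have h : M.edge (Quotient.out (M.edge d)) = M.edge d := Quotient.out_eq _
  simp only [ofCurvature]
  rcases M.edge_eq_iff.1 h with h | h
  · rw [h]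
  · rw [h, M.opp_opp, centerDistOf_comm]

variable {M Θ k}

theorem PatternData.ofCurvature_sectorsDisjoint (hΘ : ∀ e, Θ e ∈ Set.Ioc 0 (π / 2))
    (hk : ∀ f, 0 < k f) : (ofCurvature M Θ k).SectorsDisjoint := by
  have hc : ∀ d, 0 < centralAngleOf M Θ k d := fun d => mul_pos two_pos (halfAngle_pos _ _ _)
  have hmono := M.partialAngle_mono hc
  have hlt : ∀ d d', M.face d = M.face d' → M.index d < M.index d' →
      M.partialAngle (centralAngleOf M Θ k) (M.face d) (M.index d) + centralAngleOf M Θ k d ≤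
        M.partialAngle (centralAngleOf M Θ k) (M.face d') (M.index d') := by
    intro d d' hf hi
    rw [M.partialAngle_index_add, hf]
    exact hmono _ hi
  refine ⟨fun f => ?_, fun d => ?_, fun d => ?_, fun d => ?_, fun d d' hf hne => ?_⟩
  · have := (radiusOf_mem (hk f)).2
    have h : (ofCurvature M Θ k).radius f = radiusOf (k f) := rfl
    linarith [pi_pos]
  · have := halfAngle_lt_pi_div_two (hΘ (M.edge d)) (hk (M.face d)) (hk (M.face (M.opp d)))
    have h : (ofCurvature M Θ k).centralAngle d = centralAngleOf M Θ k d := rfl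
    rw [h, centralAngleOf]
    linarith [pi_pos]
  · change 0 ≤ M.partialAngle _ _ _
    exact Finset.sum_nonneg fun _ _ => (hc _).le
  · change M.partialAngle (centralAngleOf M Θ k) (M.face d) (M.index d) +
      centralAngleOf M Θ k d ≤ ∑ᶠ d' ∈ {d' | M.face d' = M.face d}, centralAngleOf M Θ k d'
    rw [M.partialAngle_index_add, ← M.partialAngle_faceDegree]
    exact hmono _ (M.index_lt d)
  · rcases lt_trichotomy (M.index d) (M.index d') with h | h | h
    · exact Or.inl (hlt d d' hf h)
    · refine absurd ?_ hne
      rw [← M.iterate_index d, ← M.iterate_index d', h, hf]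
    · exact Or.inr (hlt d' d hf.symm h)

/-- No compatibility condition arises: each edge closes up by itself, and the cone angles are free
to be the sums of the central angles. -/
theorem IdealCirclePattern.exists_geodesicCurvature_eq (hΘ : ∀ e, Θ e ∈ Set.Ioc 0 (π / 2))
    (hk : ∀ f, 0 < k f) : ∃ P : IdealCirclePattern M Θ, P.geodesicCurvature = k := by
  have hdis := PatternData.ofCurvature_sectorsDisjoint hΘ hk
  have hr := fun f => radiusOf_mem (hk f)
  have hr0 : ∀ f, 0 < sin (radiusOf (k f)) := fun f =>
    sin_pos_of_pos_of_lt_pi (hr f).1 (by linarith [(hr f).2, pi_pos])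
  have hc : ∀ d, 0 < centralAngleOf M Θ k d := fun d => mul_pos two_pos (halfAngle_pos _ _ _)
  have hsum : ∀ f, 0 < ∑ᶠ d ∈ {d | M.face d = f}, centralAngleOf M Θ k d := by
    intro f
    rw [← M.partialAngle_faceDegree]
    have h1 : 0 < M.faceDegree f := by
      have := M.index_lt (M.baseDart f)
      rw [M.face_baseDart] at this
      exact Nat.zero_lt_of_lt this
    exact Finset.sum_pos (fun _ _ => hc _) ⟨0, by simpa using h1⟩
  have hdist : ∀ d, centerDistOf (Θ (M.edge d)) (k (M.face d)) (k (M.face (M.opp d))) ∈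
      Set.Ioo 0 π ∧ _ := fun d => arccos_centerDist_mem (hr (M.face d)) (hr (M.face (M.opp d)))
        (hΘ (M.edge d))
  have hcorner := fun d => corner_of_halfAngle (hr0 (M.face d)) (hr0 (M.face (M.opp d)))
    (sin_pos_of_mem_Ioc (hΘ (M.edge d)))
    (sin_pos_of_pos_of_lt_pi (hdist d).1.1 (hdist d).1.2) (hdist d).2
  have hangle := fun d => bigonAngle_of_halfAngle (hr0 (M.face d)) (hr0 (M.face (M.opp d)))
    (hΘ (M.edge d)) (sin_pos_of_pos_of_lt_pi (hdist d).1.1 (hdist d).1.2) (hdist d).2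
  simp only [cot_radiusOf] at hcorner hangle
  refine ⟨⟨PatternData.ofCurvature M Θ k, hr, hsum, fun d => ⟨hc d, hdis.centralAngle_lt d⟩,
    fun e => ?_, M.partialAngle_index_next _, fun _ => rfl, fun d => ?_, fun d => ?_,
    hdis.encard_fiber_le, fun _ _ => hdis.not_subset⟩, ?_⟩
  · obtain ⟨d, rfl⟩ : ∃ d, M.edge d = e := Quotient.exists_rep e
    rw [PatternData.ofCurvature_centerDist]
    exact (hdist d).1
  · rw [PatternData.ofCurvature_centerDist]
    simp only [PatternData.ofCurvature, centralAngleOf, mul_div_cancel_left₀ _ (two_ne_zero' ℝ),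
      M.edge_opp, M.opp_opp]
    exact hcorner d
  · rw [PatternData.ofCurvature_centerDist]
    simp only [PatternData.ofCurvature, centralAngleOf, mul_div_cancel_left₀ _ (two_ne_zero' ℝ)]
    exact hangle d
  · funext f
    exact cot_radiusOf (k f)

end OfCurvature

/-! ### Isometries of patterns -/

namespace ConicalDisk

variable {α r : ℝ}

/-- Rotation of a conical disk about its center. -/
def rotate (c : AddCircle α) : ConicalDisk α r ≃ ConicalDisk α r where
  toFun
    | center => center
    | polar ρ φ => polar ρ (φ + c)
  invFun
    | center => center
    | polar ρ φ => polar ρ (φ - c)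
  left_inv x := by cases x <;> simp
  right_inv x := by cases x <;> simp

theorem coneDist_rotate (c : AddCircle α) (x y : ConicalDisk α r) :
    (rotate c x).coneDist (rotate c y) = x.coneDist y := by
  cases x <;> cases y <;> simp [rotate, coneDist, rad, ang]

end ConicalDisk

namespace PatternData

variable {Dart : Type*} {M : SurfaceGraph Dart}

theorem coe_start_sub_eq [Finite Dart] {α : M.Face → ℝ} {s s' c : Dart → ℝ}
    (hs : ∀ d, ((s (M.next d) : ℝ) : AddCircle (α (M.face d))) = ((s d + c d : ℝ) : AddCircle _))
    (hs' : ∀ d, ((s' (M.next d) : ℝ) : AddCircle (α (M.face d))) = ((s' d + c d : ℝ) : AddCircle _))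
    (d : Dart) : ((s' d - s d : ℝ) : AddCircle (α (M.face d))) =
      ((s' (M.baseDart (M.face d)) - s (M.baseDart (M.face d)) : ℝ) : AddCircle _) := by
  have key : ∀ (f : M.Face) (i : ℕ),
      ((s' (M.next^[i] (M.baseDart f)) - s (M.next^[i] (M.baseDart f)) : ℝ) : AddCircle (α f)) =
        ((s' (M.baseDart f) - s (M.baseDart f) : ℝ) : AddCircle (α f)) := by
    intro f i
    induction i with
    | zero => rfl
    | succ i ih =>
      have h1 := hs (M.next^[i] (M.baseDart f))
      have h2 := hs' (M.next^[i] (M.baseDart f))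
      rw [M.face_iterate_next, M.face_baseDart] at h1 h2
      rw [← ih, Function.iterate_succ_apply', AddCircle.coe_sub, AddCircle.coe_sub, h1, h2,
        AddCircle.coe_add, AddCircle.coe_add]
      abel
  have := key (M.face d) (M.index d)
  rwa [M.iterate_index] at this

/-- Only the position of the first sector in each disk remains free. The starts in `P` and `Q`
differ by an angle constant around a face, and rotating the disk by it removes the difference. -/
theorem exists_isometry [Finite Dart] {P Q : PatternData M} (hr : P.radius = Q.radius)
    (hα : P.coneAngle = Q.coneAngle) (hc : P.centralAngle = Q.centralAngle)
    (hℓ : P.centerDist = Q.centerDist)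
    (hP : ∀ d, ((P.start (M.next d) : ℝ) : AddCircle (P.coneAngle (M.face d))) =
      ((P.start d + P.centralAngle d : ℝ) : AddCircle _))
    (hQ : ∀ d, ((Q.start (M.next d) : ℝ) : AddCircle (Q.coneAngle (M.face d))) =
      ((Q.start d + Q.centralAngle d : ℝ) : AddCircle _)) :
    ∃ h : ∀ f, P.Disk f ≃ Q.Disk f,
      (∀ f x y, (h f x).coneDist (h f y) = x.coneDist y) ∧
      (∀ d x ρ t, Q.SectorPoint d (h _ x) ρ t ↔ P.SectorPoint d x ρ t) ∧
      ∀ d x y, Q.Glued d (h _ x) (h _ y) ↔ P.Glued d x y := by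
  obtain ⟨r, α, s, c, ℓ⟩ := P
  obtain ⟨r', α', s', c', ℓ'⟩ := Q
  dsimp only at hr hα hc hℓ
  subst hr hα hc hℓ
  let h : ∀ f, ConicalDisk (α f) (r f) ≃ ConicalDisk (α f) (r f) := fun f =>
    ConicalDisk.rotate ((s' (M.baseDart f) - s (M.baseDart f) : ℝ) : AddCircle (α f))
  have hsec : ∀ d x ρ t, (PatternData.mk r α s' c ℓ).SectorPoint d (h _ x) ρ t ↔
      (PatternData.mk r α s c ℓ).SectorPoint d x ρ t := by
    intro d x ρ t
    refine and_congr Iff.rfl (exists_congr fun hρ => ?_)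
    refine (h (M.face d)).eq_symm_apply.symm.trans ?_
    have : (h (M.face d)).symm (.polar ⟨ρ, hρ⟩ ((s' d + c d / 2 + t : ℝ) : AddCircle _)) =
        .polar ⟨ρ, hρ⟩ ((s d + c d / 2 + t : ℝ) : AddCircle _) := by
      change ConicalDisk.polar _ (_ - _) = _
      congr 1
      rw [← coe_start_sub_eq hP hQ d, ← AddCircle.coe_sub]
      congr 1
      dsimp only
      ring
    rw [← this]
  refine ⟨h, fun f x y => ConicalDisk.coneDist_rotate _ x y, hsec, fun d x y => ?_⟩
  unfold Glued
  simp only [hsec]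

end PatternData

namespace IdealCirclePattern

variable {Dart : Type*}

section

variable [Finite Dart] {M : SurfaceGraph Dart} {Θ : M.Edge → ℝ}

/-! ### Patterns are determined by their geodesic curvatures -/

theorem geodesicCurvature_pos (P : IdealCirclePattern M Θ) (f : M.Face) :
    0 < P.geodesicCurvature f :=
  cot_pos_of_mem_Ioo (P.radius_mem f)

theorem radius_eq (P : IdealCirclePattern M Θ) (f : M.Face) :
    P.radius f = radiusOf (P.geodesicCurvature f) :=
  (radiusOf_cot (P.radius_mem f)).symm

theorem centralAngle_eq (hΘ : ∀ e, Θ e ∈ Set.Ioc 0 (π / 2)) (P : IdealCirclePattern M Θ)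
    (d : Dart) : P.centralAngle d = centralAngleOf M Θ P.geodesicCurvature d ∧
      P.centerDist (M.edge d) = centerDistOf (Θ (M.edge d)) (P.geodesicCurvature (M.face d))
        (P.geodesicCurvature (M.face (M.opp d))) := by
  have hc := P.centralAngle_mem d
  obtain ⟨h1, h2⟩ := eq_halfAngle_of_corner (P.radius_mem (M.face d))
    (P.radius_mem (M.face (M.opp d))) (A := P.centralAngle d / 2)
    ⟨by linarith [hc.1], by linarith [hc.2]⟩ (P.centerDist_mem (M.edge d)) (hΘ (M.edge d))
    (P.corner d) (P.angle_eq d)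
  refine ⟨?_, ?_⟩
  · rw [centralAngleOf, geodesicCurvature, geodesicCurvature, ← h1]; ring
  · rw [h2, centerDistOf, ← radius_eq, ← radius_eq]

theorem isometric_of_geodesicCurvature_eq (hΘ : ∀ e, Θ e ∈ Set.Ioc 0 (π / 2))
    {P Q : IdealCirclePattern M Θ} (h : P.geodesicCurvature = Q.geodesicCurvature) :
    P.Isometric Q := by
  have hr : P.radius = Q.radius := by
    funext f; rw [radius_eq, radius_eq, h]
  have hc : P.centralAngle = Q.centralAngle := by
    funext d; rw [(centralAngle_eq hΘ P d).1, (centralAngle_eq hΘ Q d).1, h]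
  have hα : P.coneAngle = Q.coneAngle := by
    funext f; rw [← P.sum_centralAngle, ← Q.sum_centralAngle, hc]
  have hℓ : P.centerDist = Q.centerDist := by
    funext e
    obtain ⟨d, rfl⟩ : ∃ d, M.edge d = e := Quotient.exists_rep e
    rw [(centralAngle_eq hΘ P d).2, (centralAngle_eq hΘ Q d).2, h]
  exact PatternData.exists_isometry hr hα hc hℓ P.start_next Q.start_next

end

variable [Fintype Dart] {M : SurfaceGraph Dart} {Θ : M.Edge → ℝ}

open Classical in
theorem coneAngle_eq (hΘ : ∀ e, Θ e ∈ Set.Ioc 0 (π / 2)) (P : IdealCirclePattern M Θ)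
    (f : M.Face) : P.coneAngle f =
      ∑ d, if M.face d = f then centralAngleOf M Θ P.geodesicCurvature d else 0 := by
  rw [← P.sum_centralAngle, finsum_mem_def, finsum_eq_sum_of_fintype]
  refine Finset.sum_congr rfl fun d _ => ?_
  rw [Set.indicator_apply, (centralAngle_eq hΘ P d).1]
  rfl

/-- This links patterns to the analytic system: the circumference splits over the sides of the face,
and `1 / √(1 + k ^ 2)` is the sine of the radius. -/
theorem totalCurvature_eq (hΘ : ∀ e, Θ e ∈ Set.Ioc 0 (π / 2)) (P : IdealCirclePattern M Θ) :
    P.totalCurvature = M.faceCurvature Θ P.geodesicCurvature := by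
  classical
  funext f
  rw [totalCurvature, circumference, coneAngle_eq hΘ, SurfaceGraph.faceCurvature, Finset.sum_mul,
    Finset.mul_sum]
  refine Finset.sum_congr rfl fun d _ => ?_
  split_ifs with h
  · subst h
    have hr := P.radius_mem (M.face d)
    have hs : 0 < sin (P.radius (M.face d)) :=
      sin_pos_of_pos_of_lt_pi hr.1 (by linarith [hr.2, pi_pos])
    have e : √(1 + P.geodesicCurvature (M.face d) ^ 2) = 1 / sin (P.radius (M.face d)) :=
      sqrt_one_add_cot_sq hs
    rw [SurfaceGraph.dartCurvature, arcCurvature, e, centralAngleOf, div_div_eq_mul_div, div_one]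
    ring
  · ring

/-! ### Thurston's algorithm for patterns -/

/-- The auxiliary pattern for `f` enters only through its curvature vector, which is forced to be
the update of the old one at `f`. -/
theorem ThurstonStep.curvatureStep (hΘ : ∀ e, Θ e ∈ Set.Ioc 0 (π / 2)) {T : M.Face → ℝ}
    {P P' : IdealCirclePattern M Θ} (h : ThurstonStep T P P') :
    M.CurvatureStep Θ T P.geodesicCurvature P'.geodesicCurvature := by
  classical
  refine ⟨P'.geodesicCurvature_pos, fun f => ?_⟩
  obtain ⟨Q, ⟨hQ, hT⟩, hk⟩ := h f
  have : Function.update P.geodesicCurvature f (P'.geodesicCurvature f) = Q.geodesicCurvature :=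
    Function.update_eq_iff.2 ⟨hk, fun g hg => (hQ g hg).symm⟩
  rw [← hT, totalCurvature_eq hΘ, ← this]

theorem exists_thurstonStep (hΘ : ∀ e, Θ e ∈ Set.Ioc 0 (π / 2)) {T : M.Face → ℝ}
    (hT : T ∈ M.admissible Θ) (P : IdealCirclePattern M Θ) : ∃ P', ThurstonStep T P P' := by
  classical
  obtain ⟨k', hk', hs⟩ := SurfaceGraph.exists_curvatureStep hΘ hT P.geodesicCurvature_pos
  obtain ⟨P', rfl⟩ := exists_geodesicCurvature_eq hΘ hk'
  refine ⟨P', fun f => ?_⟩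
  obtain ⟨Q, hQ⟩ := exists_geodesicCurvature_eq hΘ
    (SurfaceGraph.update_pos P.geodesicCurvature_pos f (hk' f))
  refine ⟨Q, ⟨fun g hg => ?_, ?_⟩, ?_⟩
  · rw [hQ, Function.update_of_ne hg]
  · rw [totalCurvature_eq hΘ, hQ, ← hs f]
  · rw [hQ, Function.update_self]

theorem convergesTo_of_tendsto (hΘ : ∀ e, Θ e ∈ Set.Ioc 0 (π / 2)) {D : ℕ → IdealCirclePattern M Θ}
    {Q : IdealCirclePattern M Θ}
    (h : Tendsto (fun m => (D m).geodesicCurvature) atTop (𝓝 Q.geodesicCurvature)) :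
    ConvergesTo D Q := by
  classical
  have hf := tendsto_pi_nhds.1 h
  have hp : ∀ d, Tendsto (fun m => ((D m).geodesicCurvature (M.face d),
      (D m).geodesicCurvature (M.face (M.opp d)))) atTop
      (𝓝 (Q.geodesicCurvature (M.face d), Q.geodesicCurvature (M.face (M.opp d)))) := fun d =>
    (hf (M.face d)).prodMk_nhds (hf (M.face (M.opp d)))
  have hc : ∀ d, Tendsto (fun m => centralAngleOf M Θ (D m).geodesicCurvature d) atTop
      (𝓝 (centralAngleOf M Θ Q.geodesicCurvature d)) := fun d =>
    (((continuous_halfAngle (sin_pos_of_mem_Ioc (hΘ (M.edge d)))).tendsto _).comp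
      (hp d)).const_mul 2
  refine ⟨fun f => ?_, fun f => ?_, fun d => ?_, fun e => ?_⟩
  · simp only [radius_eq]
    exact ((continuous_const.sub continuous_arctan).tendsto _).comp (hf f)
  · simp only [coneAngle_eq hΘ]
    refine tendsto_finsetSum _ fun d _ => ?_
    split_ifs
    · exact hc d
    · exact tendsto_const_nhds
  · simp only [fun P : IdealCirclePattern M Θ => (centralAngle_eq hΘ P d).1]
    exact hc d
  · obtain ⟨d, rfl⟩ : ∃ d, M.edge d = e := Quotient.exists_rep e
    have he := fun P : IdealCirclePattern M Θ => (centralAngle_eq hΘ P d).2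
    have hℓ : Tendsto (fun p : ℝ × ℝ => centerDistOf (Θ (M.edge d)) p.1 p.2)
        (𝓝 (Q.geodesicCurvature (M.face d), Q.geodesicCurvature (M.face (M.opp d))))
        (𝓝 (centerDistOf (Θ (M.edge d)) (Q.geodesicCurvature (M.face d))
          (Q.geodesicCurvature (M.face (M.opp d))))) :=
      (continuous_centerDistOf (Θ (M.edge d))).tendsto _
    rw [he Q]
    exact (hℓ.comp (hp d)).congr fun m => (he (D m)).symm

end IdealCirclePattern

end

/-! ### Transfer of the results on curvature vectors to patterns -/

theorem theorem1p3 {Dart : Type*} [Finite Dart] (M : SurfaceGraph Dart) (Θ : M.Edge → ℝ)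
    (hΘ : ∀ e, Θ e ∈ Set.Ioc 0 (Real.pi / 2)) (That : M.Face → ℝ) (hT : That ∈ M.admissible Θ) :
    ∃ Dhat : IdealCirclePattern M Θ,
      Dhat.totalCurvature = That ∧
      (∀ D : IdealCirclePattern M Θ, D.totalCurvature = That → D.Isometric Dhat) ∧
      ∀ D0 : IdealCirclePattern M Θ,
        (∃ D : ℕ → IdealCirclePattern M Θ,
          D 0 = D0 ∧ IdealCirclePattern.IsThurstonSequence That D) ∧
        ∀ D : ℕ → IdealCirclePattern M Θ,
          D 0 = D0 → IdealCirclePattern.IsThurstonSequence That D →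
          IdealCirclePattern.ConvergesTo D Dhat ∧
          Filter.Tendsto (fun m => (D m).geodesicCurvature) Filter.atTop
            (nhds Dhat.geodesicCurvature) ∧
          Filter.Tendsto (fun m => (D m).totalCurvature) Filter.atTop (nhds That) ∧
          (D0.totalCurvature ≤ That →
            (∀ f, Monotone fun m => (D m).geodesicCurvature f) ∧
            ∀ m, (D m).totalCurvature ≤ That) ∧
          (That ≤ D0.totalCurvature →
            (∀ f, Antitone fun m => (D m).geodesicCurvature f) ∧
            ∀ m, That ≤ (D m).totalCurvature) := by
  cases nonempty_fintype Dart
  have htot := fun D : IdealCirclePattern M Θ => D.totalCurvature_eq hΘ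
  obtain ⟨l, hl, hlT⟩ := SurfaceGraph.exists_faceCurvature_eq hΘ hT
  obtain ⟨Dhat, hD⟩ := IdealCirclePattern.exists_geodesicCurvature_eq hΘ hl
  refine ⟨Dhat, by rw [htot, hD, hlT], fun D h => ?_, fun D0 => ⟨?_, ?_⟩⟩
  · refine IdealCirclePattern.isometric_of_geodesicCurvature_eq hΘ ?_
    rw [hD]
    exact SurfaceGraph.faceCurvature_injective hΘ D.geodesicCurvature_pos hl
      (by rw [← htot, h, hlT])
  · choose φ hφ using IdealCirclePattern.exists_thurstonStep hΘ hT
    refine ⟨fun m => φ^[m] D0, rfl, fun m => ?_⟩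
    simp only [Function.iterate_succ_apply']
    exact hφ _
  · rintro D rfl hs
    set k : ℕ → M.Face → ℝ := fun m => (D m).geodesicCurvature with hk
    have hs' : ∀ m, M.CurvatureStep Θ That (k m) (k (m + 1)) := fun m => (hs m).curvatureStep hΘ
    have h0 : ∀ f, 0 < k 0 f := (D 0).geodesicCurvature_pos
    have hlim := SurfaceGraph.curvatureSeq_tendsto hΘ hT h0 hs' hl hlT
    have hlim' := hlim
    rw [← hD] at hlim'
    simp only [htot]
    refine ⟨IdealCirclePattern.convergesTo_of_tendsto hΘ hlim', hlim', ?_, fun h => ?_, fun h => ?_⟩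
    · rw [← hlT]
      exact tendsto_pi_nhds.2 fun f =>
        ((SurfaceGraph.continuous_faceCurvature hΘ f).tendsto l).comp hlim
    · obtain ⟨h1, h2⟩ := SurfaceGraph.curvatureSeq_monotone hΘ h0 hs' h
      exact ⟨fun f a b hab => h1 hab f, h2⟩
    · obtain ⟨h1, h2⟩ := SurfaceGraph.curvatureSeq_antitone hΘ h0 hs' h
      exact ⟨fun f a b hab => h1 hab f, h2⟩
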